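/- Let $M$ be a compact, connected smooth manifold (without boundary) of dimension $m$ with a smooth Riemannian metric $g$ and volume density $|dV_g|$. Let $\boldsymbol V\subset C^\infty(M)$ be a vector subspace of finite dimension $N\geq 1$ with a Euclidean inner product $h$, and suppose that $\boldsymbol V$ is ample: for every $x\in M$ the linear map $\mathcal A_x:\boldsymbol V\to T_x^*M$, $\mathcal A_x v=d_xv$, is surjective. For $v\in\boldsymbol V$ let $\mu(v)\in\{0,1,2,\dots,\infty\}$ be the number of critical points of $v$, let $S(\boldsymbol V)$ be the unit sphere of $(\boldsymbol V,h)$ with area density $|dS_h|$, and set $$\mu(M,g,\boldsymbol V,h):=\frac{1}{\mathrm{area}(S(\boldsymbol V))}\int_{S(\boldsymbol V)}\mu(v)\,|dS_h(v)|.$$ For $x\in M$ let $\boldsymbol K_x=\ker\mathcal A_x$ be the space of all $v\in\boldsymbol V$ that have $x$ as a critical point, with the inner product induced by $h$ and unit sphere $S(\boldsymbol K_x)$. For $v\in\boldsymbol K_x$ let $\mathrm{Hess}_x(v,g):T_xM\to T_xM$ be the operator which represents the Hessian of $v$ at $x$ with respect to $g$, and set $$\Delta_x(\boldsymbol V,g):=\int_{S(\boldsymbol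 K_x)}|\det\mathrm{Hess}_x(v,g)|\,|dS(v)|.$$ Let $\mathcal A_x^\dagger:T_xM\to\boldsymbol V$ be the dual adjunction map, defined by $h(\mathcal A_x^\dagger X,v)=d_xv(X)$ for all $v\in\boldsymbol V$ (the differential at $x$ of the evaluation map $M\to\mathrm{Hom}(\boldsymbol V,\mathbb R)\cong\boldsymbol V$), and let $J(\mathcal A_x^\dagger,g,h)=\det\big(h(\mathcal A_x^\dagger e_i,\mathcal A_x^\dagger e_j)\big)^{1/2}$ be its Jacobian, where $(e_i)$ is a $g$-orthonormal basis of $T_xM$. Let $\sigma_{N-1}=2\pi^{N/2}/\Gamma(N/2)$ be the area of the unit sphere of dimension $N-1$. Then $v\mapsto\mu(v)$ is measurable with respect to the area measure on $S(\boldsymbol V)$ (up to null sets), the function $x\mapsto\Delta_x(\boldsymbol V,g)/J(\mathcal A_x^\dagger,g,h)$ is integrable on $M$, and $$\mu(M,g,\boldsymbol V,h)=\frac{1}{\sigma_{N-1}}\int_M\frac{\Delta_x(\boldsymbol V,g)}{J(\mathcal A_x^\dagger,g,h)}\,|dV_g(x)|.$$ In particular $\mu(M,g,\boldsymbol V,h)$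 is finite. Moreover, suppose that $(M,g,\boldsymbol V,h)$ is homogeneous with respect to a compact Lie group $G$, that is, $G$ acts smoothly, transitively and isometrically on $M$, the pullback of every function in $\boldsymbol V$ by every element of $G$ is again in $\boldsymbol V$, and $h$ is invariant under these pullbacks. Then $x\mapsto\Delta_x(\boldsymbol V,g)/J(\mathcal A_x^\dagger,g,h)$ is constant on $M$, and for every $x_0\in M$ $$\mu(M,g,\boldsymbol V,h)=\frac{\Delta_{x_0}(\boldsymbol V,g)}{\sigma_{N-1}\,J(\mathcal A_{x_0}^\dagger,g,h)}\cdot\mathrm{vol}_g(M).$$ -/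

import Mathlib

open MeasureTheory Bundle Metric
open scoped Manifold ContDiff ENNReal InnerProductSpace

noncomputable section

namespace CriticalSets

/-! ### Linear algebra in Euclidean spaces -/

section Euclidean

variable {E F : Type*} [NormedAddCommGroup E] [InnerProductSpace ℝ E] [FiniteDimensional ℝ E]
  [NormedAddCommGroup F] [InnerProductSpace ℝ F]

/-- The Jacobian of a linear map `A : E → F` between Euclidean spaces with `dim E ≤ dim F`: the
square root of the determinant of the Gram matrix `⟪A eᵢ, A eⱼ⟫`, for an orthonormal basis `e`
of `E`. -/
def jacobian (A : E →ₗ[ℝ] F) : ℝ :=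
  √(Matrix.gram ℝ fun i => A (stdOrthonormalBasis ℝ E i)).det

theorem jacobian_eq {ι : Type*} [Fintype ι] [DecidableEq ι] (b : OrthonormalBasis ι ℝ E)
    [FiniteDimensional ℝ F] (A : E →ₗ[ℝ] F) :
    jacobian A = √(Matrix.gram ℝ fun i => A (b i)).det := by
  have hb : (Matrix.gram ℝ fun i => A (b i)).det = LinearMap.det (LinearMap.adjoint A ∘ₗ A) := by
    rw [← LinearMap.det_toMatrix b.toBasis]
    congr 1
    ext i j
    simp [LinearMap.toMatrix_apply, b.repr_apply_apply, LinearMap.adjoint_inner_right]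
  have hs : (Matrix.gram ℝ fun i => A (stdOrthonormalBasis ℝ E i)).det =
      LinearMap.det (LinearMap.adjoint A ∘ₗ A) := by
    rw [← LinearMap.det_toMatrix (stdOrthonormalBasis ℝ E).toBasis]
    congr 1
    ext i j
    simp [LinearMap.toMatrix_apply, OrthonormalBasis.repr_apply_apply,
      LinearMap.adjoint_inner_right]
  rw [jacobian, hs, hb]

/-- The linear operator `T` on the Euclidean space `E` that represents the bilinear form `B`, that
is, `⟪T X, Y⟫ = B X Y`. -/
def operatorOfBilin (B : E →L[ℝ] E →L[ℝ] ℝ) : E →L[ℝ] E :=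
  haveI : CompleteSpace E := FiniteDimensional.complete ℝ E
  InnerProductSpace.continuousLinearMapOfBilin (𝕜 := ℝ) B

theorem inner_operatorOfBilin (B : E →L[ℝ] E →L[ℝ] ℝ) (X Y : E) :
    ⟪operatorOfBilin B X, Y⟫_ℝ = B X Y := by
  have : CompleteSpace E := FiniteDimensional.complete ℝ E
  exact InnerProductSpace.continuousLinearMapOfBilin_apply (𝕜 := ℝ) B X Y

/-- The area measure on the unit sphere of a Euclidean space `E`. It is normalized by polar
coordinates, so the total area is `n • vol (unit ball)`, where `n = dim E`; for `n = 1` it is the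
counting measure on two points. -/
def sphereArea (E : Type*) [NormedAddCommGroup E] [InnerProductSpace ℝ E] [FiniteDimensional ℝ E]
    [MeasurableSpace E] [BorelSpace E] : Measure (sphere (0 : E) 1) :=
  (volume : Measure E).toSphere

/-- The area `σₙ = 2 π ^ ((n + 1) / 2) / Γ ((n + 1) / 2)` of the round unit sphere of
dimension `n`. -/
def sigma (n : ℕ) : ℝ :=
  2 * Real.pi ^ (((n : ℝ) + 1) / 2) / Real.Gamma (((n : ℝ) + 1) / 2)

end Euclidean

variable {m : ℕ} {M : Type*} [TopologicalSpace M] [ChartedSpace (EuclideanSpace ℝ (Fin m)) M]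

instance instFiniteDimensionalTangentSpace (x : M) :
    FiniteDimensional ℝ (TangentSpace (𝓡 m) x) :=
  inferInstanceAs (FiniteDimensional ℝ (EuclideanSpace ℝ (Fin m)))

/-! ### The Riemannian volume -/

section Volume

variable [RiemannianBundle (fun x : M => TangentSpace (𝓡 m) x)]

/-- The coordinate vector field `∂ᵢ` of the preferred chart at `x`, at the point with
coordinates `y`. -/
def coordVector (x : M) (y : EuclideanSpace ℝ (Fin m)) (i : Fin m) :
    TangentSpace (𝓡 m) ((chartAt (EuclideanSpace ℝ (Fin m)) x).symm y) :=
  mfderiv (𝓡 m) (𝓡 m) (chartAt (EuclideanSpace ℝ (Fin m)) x).symm y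
    (EuclideanSpace.single i (1 : ℝ) : EuclideanSpace ℝ (Fin m))

/-- The volume density `√(det (g (∂ᵢ, ∂ⱼ)))` in the coordinates of the preferred chart at `x`. -/
def volumeDensity (x : M) (y : EuclideanSpace ℝ (Fin m)) : ℝ :=
  √(Matrix.gram ℝ (coordVector x y)).det

variable [MeasurableSpace M]

/-- The Riemannian volume `√(det g) dy¹ ⋯ dyᵐ` on the domain of the preferred chart at `x`,
extended by zero to `M`. -/
def chartVolume (x : M) : Measure M :=
  (((volume : Measure (EuclideanSpace ℝ (Fin m))).restrict
      (chartAt (EuclideanSpace ℝ (Fin m)) x).target).withDensity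
    fun y => ENNReal.ofReal (volumeDensity x y)).map
      (chartAt (EuclideanSpace ℝ (Fin m)) x).symm

/-- The Riemannian volume measure on `M`. By the change of variables formula the measures
`chartVolume x` agree on the overlaps of the charts, so their supremum in the lattice of measures
is the measure that restricts to `chartVolume x` on the domain of each chart. -/
def riemannianVolume (m : ℕ) (M : Type*) [TopologicalSpace M]
    [ChartedSpace (EuclideanSpace ℝ (Fin m)) M]
    [RiemannianBundle (fun x : M => TangentSpace (𝓡 m) x)] [MeasurableSpace M] : Measure M :=
  ⨆ x : M, chartVolume (m := m) x

end Volume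

/-! ### The sample space -/

/-- The space `V` of smooth functions on `M`, as a Euclidean space with the inner product `h`. -/
def SampleSpace (V : Submodule ℝ C^∞⟮𝓡 m, M; ℝ⟯) (_h : InnerProductSpace.Core ℝ V) : Type _ := V

namespace SampleSpace

variable (V : Submodule ℝ C^∞⟮𝓡 m, M; ℝ⟯) (h : InnerProductSpace.Core ℝ V)

instance instNormedAddCommGroup : NormedAddCommGroup (SampleSpace V h) :=
  h.toNormedAddCommGroup

instance instInnerProductSpace : InnerProductSpace ℝ (SampleSpace V h) :=
  InnerProductSpace.ofCore h.toCore

instance instFiniteDimensional [hV : FiniteDimensional ℝ V] :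
    FiniteDimensional ℝ (SampleSpace V h) := hV

instance instCompleteSpace [FiniteDimensional ℝ V] : CompleteSpace (SampleSpace V h) :=
  FiniteDimensional.complete ℝ _

instance instMeasurableSpace : MeasurableSpace (SampleSpace V h) := borel _

instance instBorelSpace : BorelSpace (SampleSpace V h) := ⟨rfl⟩

variable {V h}

/-- An element of the sample space, as a smooth function. -/
def toSmooth (v : SampleSpace V h) : C^∞⟮𝓡 m, M; ℝ⟯ := Subtype.val (show V from v)

instance instCoeFun : CoeFun (SampleSpace V h) fun _ => M → ℝ := ⟨fun v => v.toSmooth⟩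

theorem coe_add (u v : SampleSpace V h) : ((u + v : SampleSpace V h) : M → ℝ) = u + v := rfl

theorem coe_smul (c : ℝ) (v : SampleSpace V h) :
    ((c • v : SampleSpace V h) : M → ℝ) = c • (v : M → ℝ) := rfl

theorem inner_def (u v : SampleSpace V h) : ⟪u, v⟫_ℝ = h.inner u v := rfl

theorem mdifferentiableAt (v : SampleSpace V h) (x : M) :
    MDifferentiableAt (𝓡 m) 𝓘(ℝ, ℝ) (v : M → ℝ) x :=
  v.toSmooth.contMDiff.mdifferentiable (by simp) x

end SampleSpace

section Sample

variable {V : Submodule ℝ C^∞⟮𝓡 m, M; ℝ⟯} {h : InnerProductSpace.Core ℝ V}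

/-- The adjunction map `𝒜ₓ : V → T*ₓM`, `v ↦ dₓv`. -/
def adjunction (x : M) : SampleSpace V h →ₗ[ℝ] (TangentSpace (𝓡 m) x →L[ℝ] ℝ) where
  toFun v := mvfderiv (𝓡 m) (v : M → ℝ) x
  map_add' u v := by
    rw [SampleSpace.coe_add]
    exact mvfderiv_add (u.mdifferentiableAt x) (v.mdifferentiableAt x)
  map_smul' c v := by
    rw [SampleSpace.coe_smul]
    exact const_smul_mfderiv (v.mdifferentiableAt x) c

/-- The set of critical points of `v`. -/
def criticalSet (v : SampleSpace V h) : Set M := {x | adjunction x v = 0}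

/-- The number of critical points of `v`, possibly infinite. -/
def criticalCount (v : SampleSpace V h) : ℝ≥0∞ := (criticalSet v).encard

variable (V h) in
/-- Ampleness: for every `x`, every covector at `x` is the differential at `x` of some `v ∈ V`. -/
def IsAmple : Prop :=
  ∀ x : M, Function.Surjective (adjunction (V := V) (h := h) x)

variable (V h) in
/-- The space `Kₓ` of all `v ∈ V` that have `x` as a critical point. -/
def kernelSpace (x : M) : Submodule ℝ (SampleSpace V h) := LinearMap.ker (adjunction x)

/-- The dual adjunction map `𝒜ₓ† : TₓM → V`, with the dual of `V` identified with `V` by the inner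
product `h`. It is the differential at `x` of the evaluation map `M → V* ≅ V`. -/
def dualAdjunction [FiniteDimensional ℝ V] (x : M) :
    TangentSpace (𝓡 m) x →ₗ[ℝ] SampleSpace V h where
  toFun X := (InnerProductSpace.toDual ℝ (SampleSpace V h)).symm
    (LinearMap.toContinuousLinearMap
      { toFun := fun v => adjunction x v X
        map_add' := fun u v => by simp
        map_smul' := fun c v => by simp })
  map_add' X Y := by
    rw [← map_add]
    congr 1
    ext v
    simp
  map_smul' c X := by
    refine ext_inner_right ℝ fun v => ?_
    rw [InnerProductSpace.toDual_symm_apply, RingHom.id_apply, real_inner_smul_left,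
      InnerProductSpace.toDual_symm_apply]
    simp

theorem inner_dualAdjunction [FiniteDimensional ℝ V] (x : M) (X : TangentSpace (𝓡 m) x)
    (v : SampleSpace V h) : ⟪dualAdjunction x X, v⟫_ℝ = adjunction x v X := by
  simp [dualAdjunction, InnerProductSpace.toDual_symm_apply]

end Sample

/-- The Hessian at `x` of a function `f` on `M`, computed in the preferred chart at `x`:
`Hessₓ(f)(X, Y) = ∑ᵢⱼ Xⁱ Yʲ ∂ᵢ∂ⱼf(x)`. If `x` is a critical point of `f` it does not depend on the
chart. -/
def hessian (f : M → ℝ) (x : M) :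
    TangentSpace (𝓡 m) x →L[ℝ] TangentSpace (𝓡 m) x →L[ℝ] ℝ :=
  let φ := chartAt (EuclideanSpace ℝ (Fin m)) x
  let D : TangentSpace (𝓡 m) x →L[ℝ] EuclideanSpace ℝ (Fin m) := mfderiv (𝓡 m) (𝓡 m) φ x
  let H : EuclideanSpace ℝ (Fin m) →L[ℝ] EuclideanSpace ℝ (Fin m) →L[ℝ] ℝ :=
    fderiv ℝ (fderiv ℝ (f ∘ φ.symm)) (φ x)
  (ContinuousLinearMap.precomp ℝ D).comp (H.comp D)

theorem hessian_apply (f : M → ℝ) (x : M) (X Y : TangentSpace (𝓡 m) x) :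
    hessian f x X Y =
      fderiv ℝ (fderiv ℝ (f ∘ (chartAt (EuclideanSpace ℝ (Fin m)) x).symm))
        (chartAt (EuclideanSpace ℝ (Fin m)) x x)
        (mfderiv (𝓡 m) (𝓡 m) (chartAt (EuclideanSpace ℝ (Fin m)) x) x X)
        (mfderiv (𝓡 m) (𝓡 m) (chartAt (EuclideanSpace ℝ (Fin m)) x) x Y) := rfl

section Main

variable (V : Submodule ℝ C^∞⟮𝓡 m, M; ℝ⟯) (h : InnerProductSpace.Core ℝ V)
  [FiniteDimensional ℝ V]

/-- The expected number of critical points of a random function on the unit sphere of `(V, h)`. -/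
def expectation : ℝ≥0∞ :=
  (∫⁻ v, criticalCount (v : SampleSpace V h) ∂(sphereArea (SampleSpace V h))) /
    sphereArea (SampleSpace V h) Set.univ

variable [RiemannianBundle (fun x : M => TangentSpace (𝓡 m) x)]

/-- The Hessian operator `Hessₓ(f, g) : TₓM → TₓM`. -/
def hessianOperator (f : M → ℝ) (x : M) : TangentSpace (𝓡 m) x →L[ℝ] TangentSpace (𝓡 m) x :=
  operatorOfBilin (hessian f x)

/-- `Δₓ(V, g)`, the integral of `|det Hessₓ(v, g)|` over the unit sphere of `Kₓ`. -/
def hessianAverage (x : M) : ℝ :=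
  ∫ v : sphere (0 : kernelSpace V h x) 1,
    |(hessianOperator (m := m) (v.1.1 : SampleSpace V h).toSmooth x).det| ∂(sphereArea (kernelSpace V h x))

/-- The integrand `Δₓ(V, g) / J(𝒜ₓ†, g, h)`. -/
def criticalDensity (x : M) : ℝ :=
  hessianAverage V h x / jacobian (dualAdjunction (V := V) (h := h) x)

end Main

/-- The quadruple `(M, g, V, h)` is homogeneous with respect to the group `G` acting on `M`: the
action is transitive and preserves the metric `g`, the pullback of a function in `V` by an element
of `G` is again in `V`, and `h` is invariant under these pullbacks. -/
structure IsHomogeneous [RiemannianBundle (fun x : M => TangentSpace (𝓡 m) x)]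
    (V : Submodule ℝ C^∞⟮𝓡 m, M; ℝ⟯) (h : InnerProductSpace.Core ℝ V)
    (G : Type*) [Group G] [MulAction G M] : Prop where
  transitive : ∀ x y : M, ∃ a : G, a • x = y
  isometric : ∀ (a : G) (x : M) (X Y : TangentSpace (𝓡 m) x),
    ⟪mfderiv (𝓡 m) (𝓡 m) (fun z : M => a • z) x X,
      mfderiv (𝓡 m) (𝓡 m) (fun z : M => a • z) x Y⟫_ℝ = ⟪X, Y⟫_ℝ
  pullback_mem : ∀ (a : G) (v : SampleSpace V h), ∃ w : SampleSpace V h, ∀ x, w x = v (a • x)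
  inner_pullback : ∀ (a : G) (u v u' v' : SampleSpace V h),
    (∀ x, u' x = u (a • x)) → (∀ x, v' x = v (a • x)) → ⟪u', v'⟫_ℝ = ⟪u, v⟫_ℝ

end CriticalSets

end

noncomputable section

namespace CriticalSets

/-! ### The area formula with multiplicity -/

section AreaFormula

open Set

/-! The incidence set `{(x, v) : d_x v = 0}` is projected to `V` and to `M`. Its fibre over `v` is
the critical set, and its fibre over `x` is `K_x`. Integrating the fibre count over the unit ball of
`V` and exchanging the order of integration gives an integral over `M` of integrals over `K_x`. The
exchange is made explicit in a chart.

In coordinates the gradient is a linear map `A_y : V → ℝ^m`, onto by ampleness. Near `y₀` put `K =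
ker A_{y₀}` and let `R` be an isometry of `ℝ^m` onto `Kᗮ`; then `A_y R` stays invertible, and `A_y
(R p + w) = 0` is solved by `p = G(y, w)`. Thus the zeros of `A · v`, for `v = R p + w`, are the
preimages of `(p, w)` under `Φ(y, w) = (G(y, w), w)`, a `C¹` map between spaces of equal dimension,
and `area_formula` counts them. Differentiating the equation gives `|det ∂_y G| = |det A_y R|⁻¹ |det
(∂_y A) v|` (`abs_det_fderiv_graphSolution`), and the oblique projection of `K` onto `ker A_y` turns
the first factor into `1 / J(A_y†)` (`lintegral_oblique`). The result is
`exists_ball_lintegral_zeros`.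

Let `D` be the differential of the inverse chart, so that `J(D)` is the Riemannian density. At a
critical point `(∂_y A) v = D† Hess D`, which contributes `J(D)²`, and `A_y† = 𝒜† D` contributes
`J(D)⁻¹`; exactly one factor `J(D)` is left to form the volume (`finrank_mul_zeroDensity`).

Balls are replaced by spheres through homogeneity. The count has degree `0` on a space of dimension
`N`, while `|det Hess|` has degree `m` on a space of dimension `N - m`; both produce the same factor
`N`. A finite partition of `M` into chart pieces globalizes the formula. In the homogeneous case
each group element acts by isometries on `M` and on `V`, and every ingredient of the density is
natural under it. -/

theorem encard_eq_tsum_indicator {α : Type*} (s : Set α) :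
    ((s.encard : ℕ∞) : ℝ≥0∞) = ∑' x, s.indicator (fun _ => (1 : ℝ≥0∞)) x := by
  rw [← ENNReal.tsum_set_one, tsum_subtype s (fun _ => (1 : ℝ≥0∞))]

theorem encard_iUnion_eq_tsum {α ι : Type*} {s : ι → Set α}
    (hs : Pairwise (Function.onFun Disjoint s)) :
    (((⋃ i, s i).encard : ℕ∞) : ℝ≥0∞) = ∑' i, ((s i).encard : ℝ≥0∞) := by
  simp_rw [encard_eq_tsum_indicator]
  rw [ENNReal.tsum_comm]
  refine tsum_congr fun x => ?_
  by_cases hx : x ∈ ⋃ i, s i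
  · obtain ⟨i, hi⟩ := mem_iUnion.1 hx
    rw [tsum_eq_single i]
    · simp [hi, hx]
    · intro j hj
      exact indicator_of_notMem (fun hxj => (disjoint_left.1 (hs hj) hxj hi)) _
  · rw [indicator_of_notMem hx, eq_comm, ENNReal.tsum_eq_zero]
    exact fun i => indicator_of_notMem (fun hi => hx (mem_iUnion.2 ⟨i, hi⟩)) _

theorem encard_inter_preimage_of_injOn {α β : Type*} {f : α → β} {s : Set α} (hf : InjOn f s)
    (y : β) :
    (((s ∩ f ⁻¹' {y}).encard : ℕ∞) : ℝ≥0∞) = (f '' s).indicator (fun _ => (1 : ℝ≥0∞)) y := by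
  by_cases hy : y ∈ f '' s
  · obtain ⟨x, hx, rfl⟩ := hy
    have : s ∩ f ⁻¹' {f x} = {x} := by
      ext z
      constructor
      · rintro ⟨hz, hzx⟩
        exact hf hz hx hzx
      · rintro rfl
        exact ⟨hx, rfl⟩
    rw [this, indicator_of_mem (mem_image_of_mem f hx)]
    simp
  · have : s ∩ f ⁻¹' {y} = ∅ := by
      ext z
      simp only [mem_inter_iff, mem_preimage, mem_singleton_iff, mem_empty_iff_false, iff_false,
        not_and]
      exact fun hz hzy => hy ⟨z, hz, hzy⟩
    simp [this, hy]

variable {E : Type*} [NormedAddCommGroup E] [NormedSpace ℝ E] [FiniteDimensional ℝ E]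

/-- A small perturbation of an invertible linear map is injective. A radius is also supplied for
singular `A`, where it carries no information, because the partition theorem in `area_formula` asks
for a radius at every linear map. -/
theorem exists_injOn_of_approximatesLinearOn (A : E →L[ℝ] E) :
    ∃ r : NNReal, r ≠ 0 ∧ (A.det ≠ 0 → ∀ (f : E → E) (s : Set E),
      ApproximatesLinearOn f A s r → InjOn f s) := by
  have : CompleteSpace E := FiniteDimensional.complete ℝ E
  by_cases hA : A.det = 0
  · exact ⟨1, one_ne_zero, fun h => (h hA).elim⟩
  rcases subsingleton_or_nontrivial E with hE | hE
  · exact ⟨1, one_ne_zero, fun _ f s _ x _ y _ _ => Subsingleton.elim x y⟩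
  set B := A.toContinuousLinearEquivOfDetNeZero hA with hB
  have hBA : (B : E →L[ℝ] E) = A := by ext; simp [hB]
  have hpos : 0 < ‖(B.symm : E →L[ℝ] E)‖₊⁻¹ := by
    rw [inv_pos]
    exact B.nnnorm_symm_pos
  -- Injectivity needs a constant strictly below `‖B⁻¹‖⁻¹`, hence the half.
  refine ⟨‖(B.symm : E →L[ℝ] E)‖₊⁻¹ / 2, (half_pos hpos).ne', fun _ f s hf => ?_⟩
  rw [← hBA] at hf
  exact hf.injOn (Or.inr (NNReal.half_lt_self hpos.ne'))

variable [MeasurableSpace E] [BorelSpace E] (μ : Measure E) [μ.IsAddHaarMeasure]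

/-- The points where the derivative is singular have a null image and contribute nothing to either
side. The rest splits into countably many measurable pieces on which `f` is injective; there the
count is the indicator of the image, and the injective change of variables applies. -/
theorem area_formula {f : E → E} {s : Set E} (hs : MeasurableSet s)
    (hf : ∀ x ∈ s, DifferentiableAt ℝ f x) :
    AEMeasurable (fun y => (((s ∩ f ⁻¹' {y}).encard : ℕ∞) : ℝ≥0∞)) μ ∧
    ∀ g : E → ℝ≥0∞, Measurable g →
      ∫⁻ y, ((s ∩ f ⁻¹' {y}).encard : ℝ≥0∞) * g y ∂μ =
        ∫⁻ x in s, ENNReal.ofReal |(fderiv ℝ f x).det| * g (f x) ∂μ := by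
  have : CompleteSpace E := FiniteDimensional.complete ℝ E
  have hdet : Measurable fun x => (fderiv ℝ f x).det :=
    ContinuousLinearMap.continuous_det.measurable.comp (measurable_fderiv ℝ f)
  set c : Set E := {x | (fderiv ℝ f x).det = 0} with hc
  have hcm : MeasurableSet c := hdet (measurableSet_singleton 0)
  have hder : ∀ t ⊆ s, ∀ x ∈ t, HasFDerivWithinAt f (fderiv ℝ f x) t x :=
    fun t ht x hx => (hf x (ht hx)).hasFDerivAt.hasFDerivWithinAt
  have hnull : μ (f '' (s ∩ c)) = 0 :=
    addHaar_image_eq_zero_of_det_fderivWithin_eq_zero μ (hder _ inter_subset_left)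
      fun x hx => hx.2
  choose r hr0 hr using exists_injOn_of_approximatesLinearOn (E := E)
  obtain ⟨t, A, htd, htm, htc, hta, htA⟩ :=
    exists_partition_approximatesLinearOn_of_hasFDerivWithinAt f (s \ c) (fderiv ℝ f)
      (hder _ sdiff_subset) r hr0
  have hinj : ∀ n, InjOn f ((s \ c) ∩ t n) := by
    intro n
    rcases (s \ c).eq_empty_or_nonempty with he | hne
    · simp [he]
    obtain ⟨y, hy, hAy⟩ := htA hne n
    refine hr (A n) ?_ f _ (hta n)
    rw [hAy]
    exact hy.2
  have hpm : ∀ n, MeasurableSet ((s \ c) ∩ t n) := fun n => (hs.diff hcm).inter (htm n)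
  have hpd : Pairwise (Function.onFun Disjoint fun n => (s \ c) ∩ t n) := fun i j hij =>
    (htd hij).mono inter_subset_right inter_subset_right
  have hpu : s \ c = ⋃ n, (s \ c) ∩ t n := by
    rw [← inter_iUnion, inter_eq_left.2 htc]
  have hpi : ∀ n, MeasurableSet (f '' ((s \ c) ∩ t n)) := fun n =>
    measurable_image_of_fderivWithin (hpm n)
      (hder _ (inter_subset_left.trans sdiff_subset)) (hinj n)
  have hcount : (fun y => (((s ∩ f ⁻¹' {y}).encard : ℕ∞) : ℝ≥0∞)) =ᵐ[μ]
      fun y => ∑' n, (f '' ((s \ c) ∩ t n)).indicator (fun _ => (1 : ℝ≥0∞)) y := by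
    have h0 : ∀ᵐ y ∂μ, y ∉ f '' (s ∩ c) := measure_eq_zero_iff_ae_notMem.1 hnull
    -- Off the null set of critical values the whole fibre lies in `s \ c`.
    filter_upwards [h0] with y hy
    have h1 : s ∩ f ⁻¹' {y} = ⋃ n, ((s \ c) ∩ t n) ∩ f ⁻¹' {y} := by
      rw [← iUnion_inter, ← hpu]
      ext x
      simp only [mem_inter_iff, mem_sdiff]
      constructor
      · rintro ⟨hx, hxy⟩
        exact ⟨⟨hx, fun hxc => hy ⟨x, ⟨hx, hxc⟩, hxy⟩⟩, hxy⟩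
      · rintro ⟨⟨hx, -⟩, hxy⟩
        exact ⟨hx, hxy⟩
    rw [h1, encard_iUnion_eq_tsum]
    · exact tsum_congr fun n => encard_inter_preimage_of_injOn (hinj n) y
    · exact fun i j hij => (hpd hij).mono inter_subset_left inter_subset_left
  have hmeas : ∀ n, Measurable ((f '' ((s \ c) ∩ t n)).indicator (fun _ => (1 : ℝ≥0∞))) :=
    fun n => measurable_const.indicator (hpi n)
  refine ⟨⟨_, Measurable.tsum hmeas, hcount⟩, fun g hg => ?_⟩
  calc ∫⁻ y, ((s ∩ f ⁻¹' {y}).encard : ℝ≥0∞) * g y ∂μ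
      = ∫⁻ y, ∑' n, (f '' ((s \ c) ∩ t n)).indicator (fun _ => (1 : ℝ≥0∞)) y * g y ∂μ := by
        refine lintegral_congr_ae ?_
        filter_upwards [hcount] with y hy
        rw [hy, ENNReal.tsum_mul_right]
    _ = ∑' n, ∫⁻ y, (f '' ((s \ c) ∩ t n)).indicator (fun _ => (1 : ℝ≥0∞)) y * g y ∂μ :=
        lintegral_tsum fun n => ((hmeas n).mul hg).aemeasurable
    _ = ∑' n, ∫⁻ x in (s \ c) ∩ t n, ENNReal.ofReal |(fderiv ℝ f x).det| * g (f x) ∂μ := by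
        refine tsum_congr fun n => ?_
        rw [← lintegral_image_eq_lintegral_abs_det_fderiv_mul μ (hpm n)
          (hder _ (inter_subset_left.trans sdiff_subset)) (hinj n) g, ← lintegral_indicator (hpi n)]
        refine lintegral_congr fun y => ?_
        by_cases hy : y ∈ f '' ((s \ c) ∩ t n) <;> simp [hy]
    _ = ∫⁻ x in s \ c, ENNReal.ofReal |(fderiv ℝ f x).det| * g (f x) ∂μ := by
        rw [← lintegral_iUnion hpm hpd, ← hpu]
    _ = ∫⁻ x in s, ENNReal.ofReal |(fderiv ℝ f x).det| * g (f x) ∂μ := by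
        rw [← lintegral_inter_add_sdiff _ s hcm]
        have : ∫⁻ x in s ∩ c, ENNReal.ofReal |(fderiv ℝ f x).det| * g (f x) ∂μ = 0 := by
          rw [setLIntegral_congr_fun (g := fun _ => 0) (hs.inter hcm) (fun x hx => ?_)]
          · simp
          · have h0 : (fderiv ℝ f x).det = 0 := hx.2
            simp [h0]
        rw [this, zero_add]

end AreaFormula

/-! ### Jacobians and integration along complementary subspaces -/

section Complement

variable {E F : Type*} [NormedAddCommGroup E] [InnerProductSpace ℝ E] [FiniteDimensional ℝ E]
  [NormedAddCommGroup F] [InnerProductSpace ℝ F] [FiniteDimensional ℝ F]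

theorem jacobian_eq_sqrt_det_adjoint_comp (B : E →ₗ[ℝ] F) :
    jacobian B = √(LinearMap.det (LinearMap.adjoint B ∘ₗ B)) := by
  rw [jacobian, ← LinearMap.det_toMatrix (stdOrthonormalBasis ℝ E).toBasis]
  congr 2
  ext i j
  simp [LinearMap.toMatrix_apply, OrthonormalBasis.repr_apply_apply,
    LinearMap.adjoint_inner_right]

theorem det_adjoint (T : E →ₗ[ℝ] E) :
    LinearMap.det (LinearMap.adjoint T) = LinearMap.det T := by
  rw [← LinearMap.det_toMatrix (stdOrthonormalBasis ℝ E).toBasis,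
    ← LinearMap.det_toMatrix (stdOrthonormalBasis ℝ E).toBasis, LinearMap.toMatrix_adjoint,
    Matrix.det_conjTranspose, star_trivial]

/-- `A` identifies `(ker A)ᗮ` with `E`, so the two have the same dimension. -/
theorem exists_isometry_range_eq_orthogonal_ker (A : F →ₗ[ℝ] E) (hA : Function.Surjective A) :
    ∃ S : E →ₗᵢ[ℝ] F, LinearMap.range S.toLinearMap = (LinearMap.ker A)ᗮ := by
  have h1 := LinearMap.finrank_range_add_finrank_ker A
  have h2 := (LinearMap.ker A).finrank_add_finrank_orthogonal
  rw [LinearMap.range_eq_top.2 hA, finrank_top] at h1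
  have h3 : Module.finrank ℝ E = Module.finrank ℝ (LinearMap.ker A)ᗮ := by omega
  let e : E ≃ₗᵢ[ℝ] (LinearMap.ker A)ᗮ :=
    (stdOrthonormalBasis ℝ E).equiv (stdOrthonormalBasis ℝ (LinearMap.ker A)ᗮ) (finCongr h3)
  refine ⟨(LinearMap.ker A)ᗮ.subtypeₗᵢ.comp e.toLinearIsometry, ?_⟩
  ext v
  constructor
  · rintro ⟨x, rfl⟩
    exact (e x).2
  · intro hv
    exact ⟨e.symm ⟨v, hv⟩, by simp⟩

/-- `A†` takes its values in `(ker A)ᗮ`, the range of `S`, so `S S† A† = A†`. Therefore `A A† = (A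
S)(A S)†`, whose determinant is `det (A S)²`. -/
theorem jacobian_adjoint_eq_abs_det (A : F →ₗ[ℝ] E) (S : E →ₗᵢ[ℝ] F)
    (hS : LinearMap.range S.toLinearMap = (LinearMap.ker A)ᗮ) :
    jacobian (LinearMap.adjoint A) = |LinearMap.det (A ∘ₗ S.toLinearMap)| := by
  have hmem : ∀ x, LinearMap.adjoint A x ∈ (LinearMap.ker A)ᗮ := by
    intro x v hv
    rw [LinearMap.adjoint_inner_right, LinearMap.mem_ker.1 hv, inner_zero_left]
  have hSS : ∀ x, S (LinearMap.adjoint S.toLinearMap (LinearMap.adjoint A x)) =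
      LinearMap.adjoint A x := by
    intro x
    have := hmem x
    rw [← hS] at this
    obtain ⟨p, hp⟩ := this
    rw [← hp]
    have : LinearMap.adjoint S.toLinearMap (S p) = p := by
      refine ext_inner_right ℝ fun q => ?_
      rw [LinearMap.adjoint_inner_left]
      exact S.inner_map_map p q
    exact congrArg S this
  have hcomp : LinearMap.adjoint (LinearMap.adjoint A) ∘ₗ LinearMap.adjoint A =
      (A ∘ₗ S.toLinearMap) ∘ₗ LinearMap.adjoint (A ∘ₗ S.toLinearMap) := by
    rw [LinearMap.adjoint_adjoint, LinearMap.adjoint_comp]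
    ext x
    exact (congrArg A (hSS x)).symm
  rw [jacobian_eq_sqrt_det_adjoint_comp, hcomp, LinearMap.det_comp, det_adjoint,
    Real.sqrt_mul_self_eq_abs]

variable [MeasurableSpace E] [BorelSpace E] [MeasurableSpace F] [BorelSpace F]

/-- Orthogonal coordinates: if `S` is an isometry of `E` onto the orthogonal complement of `K`,
then `(p, w) ↦ S p + w` is a volume preserving equivalence. -/
theorem exists_measurePreserving_orthogonal (K : Submodule ℝ F) (S : E →ₗᵢ[ℝ] F)
    (hS : LinearMap.range S.toLinearMap = Kᗮ) :
    ∃ e : E × K ≃ᵐ F, MeasurePreserving e ∧ ∀ z, e z = S z.1 + z.2 := by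
  have hSK : ∀ (p : E) (w : K), ⟪S p, (w : F)⟫_ℝ = 0 := by
    intro p w
    have : S p ∈ Kᗮ := hS ▸ ⟨p, rfl⟩
    exact Submodule.inner_left_of_mem_orthogonal w.2 this
  -- The product `E × K` carries the sup norm; the map is an isometry only for the `L²` norm, and
  -- passing between the two norms preserves volume.
  let L : WithLp 2 (E × K) →ₗᵢ[ℝ] F :=
    { toFun := fun z => S z.fst + z.snd
      map_add' := fun a b => by
        simp only [WithLp.add_fst, WithLp.add_snd, map_add, Submodule.coe_add]
        abel
      map_smul' := fun c a => by simp
      norm_map' := fun z => by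
        rw [WithLp.prod_norm_eq_of_L2]
        rw [eq_comm, Real.sqrt_eq_iff_mul_self_eq (by positivity) (by positivity)]
        have := norm_add_sq_eq_norm_sq_add_norm_sq_real (hSK z.fst z.snd)
        simp only [S.norm_map] at this
        simp only [LinearMap.coe_mk, AddHom.coe_mk]
        rw [this]
        simp only [sq, Submodule.coe_norm] }
  have hL : Function.Surjective L := by
    intro v
    obtain ⟨w, hw, u, hu, hv⟩ := K.exists_add_mem_mem_orthogonal v
    rw [← hS] at hu
    obtain ⟨p, rfl⟩ := hu
    refine ⟨WithLp.toLp 2 (p, ⟨w, hw⟩), ?_⟩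
    rw [hv, add_comm]
    rfl
  let e := LinearIsometryEquiv.ofSurjective L hL
  refine ⟨(MeasurableEquiv.toLp 2 (E × K)).trans e.toMeasurableEquiv, ?_, fun z => rfl⟩
  exact e.measurePreserving.comp (WithLp.volume_preserving_toLp E K)

theorem lintegral_eq_lintegral_orthogonal (K : Submodule ℝ F) (S : E →ₗᵢ[ℝ] F)
    (hS : LinearMap.range S.toLinearMap = Kᗮ) {f : F → ℝ≥0∞} (hf : Measurable f) :
    ∫⁻ v, f v = ∫⁻ p : E, ∫⁻ w : K, f (S p + w) := by
  obtain ⟨e, he, heq⟩ := exists_measurePreserving_orthogonal K S hS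
  rw [← he.lintegral_comp hf]
  rw [Measure.volume_eq_prod, lintegral_prod (fun z => f (e z)) (hf.comp e.measurable).aemeasurable]
  simp_rw [heq]

/-- The value does not depend on `c`; this makes the inner integrals in `lintegral_oblique` constant
along the other variable. -/
theorem lintegral_indicator_ball_linear (T : E →ₗ[ℝ] E) (hT : LinearMap.det T ≠ 0) (c : E) :
    ∫⁻ p : E, (ball (0 : E) 1).indicator (fun _ => (1 : ℝ≥0∞)) (T p + c) =
      ENNReal.ofReal |(LinearMap.det T)⁻¹| * volume (ball (0 : E) 1) := by
  have hTm : Measurable T := T.continuous_of_finiteDimensional.measurable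
  have : (fun p : E => (ball (0 : E) 1).indicator (fun _ => (1 : ℝ≥0∞)) (T p + c)) =
      (T ⁻¹' (ball (-c) 1)).indicator fun _ => 1 := by
    ext p
    simp only [Set.indicator, mem_ball, Set.mem_preimage, dist_eq_norm,
      sub_neg_eq_add, sub_zero]
  rw [this, lintegral_indicator (hTm measurableSet_ball), setLIntegral_one,
    Measure.addHaar_preimage_linearMap _ hT, Measure.addHaar_ball_center]

/-- Integration over two complements of the same subspace: the oblique projection
`w ↦ w - R (A R)⁻¹ A w` from `K` onto `ker A` multiplies volumes by `J(A†) / |det (A R)|`. -/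
theorem lintegral_oblique (A : F →ₗ[ℝ] E) (hA : Function.Surjective A) (K : Submodule ℝ F)
    (R : E →ₗᵢ[ℝ] F) (hR : LinearMap.range R.toLinearMap = Kᗮ) (T : E →ₗ[ℝ] E)
    (hT : ∀ p, A (R (T p)) = p) {g : F → ℝ≥0∞} (hg : Measurable g) :
    ENNReal.ofReal |LinearMap.det (A ∘ₗ R.toLinearMap)|⁻¹ * ∫⁻ w : K, g (w - R (T (A w))) =
      ENNReal.ofReal (jacobian (LinearMap.adjoint A))⁻¹ * ∫⁻ k : LinearMap.ker A, g k := by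
  have hAm : Measurable A := A.continuous_of_finiteDimensional.measurable
  have hTm : Measurable T := T.continuous_of_finiteDimensional.measurable
  have hRm : Measurable R := R.continuous.measurable
  have hcomp : (A ∘ₗ R.toLinearMap) ∘ₗ T = LinearMap.id := LinearMap.ext hT
  have hcomp' : T ∘ₗ (A ∘ₗ R.toLinearMap) = LinearMap.id := (LinearMap.comp_eq_id_comm ℝ E).1 hcomp
  have hTl : ∀ p, T (A (R p)) = p := fun p => LinearMap.congr_fun hcomp' p
  have hdet : LinearMap.det (A ∘ₗ R.toLinearMap) ≠ 0 := by
    intro h0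
    have := congrArg LinearMap.det hcomp
    rw [LinearMap.det_comp, h0, zero_mul, LinearMap.det_id] at this
    exact zero_ne_one this
  obtain ⟨S, hS⟩ := exists_isometry_range_eq_orthogonal_ker A hA
  have hSdet : LinearMap.det (A ∘ₗ S.toLinearMap) ≠ 0 := by
    intro h0
    obtain ⟨p, hp, hp0⟩ := SetLike.exists_of_lt (bot_lt_iff_ne_bot.2
      (fun hb => (LinearMap.bot_lt_ker_of_det_eq_zero h0).ne' hb))
    have h1 : S p ∈ LinearMap.ker A := hp
    have h2 : S p ∈ (LinearMap.ker A)ᗮ := hS ▸ ⟨p, rfl⟩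
    have h3 : S p = 0 := by
      have := Submodule.inner_right_of_mem_orthogonal h1 h2
      exact inner_self_eq_zero.1 this
    exact hp0 ((Submodule.mem_bot ℝ).2 (S.injective (h3.trans (map_zero S).symm)))
  set B : ℝ≥0∞ := volume (ball (0 : E) 1) with hB
  have hB0 : B ≠ 0 := (measure_ball_pos _ _ one_pos).ne'
  have hBt : B ≠ ⊤ := measure_ball_lt_top.ne
  -- The integral of `χ (A v) * g (Q v)` over `F` is computed by Fubini for the two splittings
  -- `range R ⊕ K` and `(ker A)ᗮ ⊕ ker A`. The cutoff `χ` makes the transverse integral finite and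
  -- nonzero, so that it can be cancelled.
  set χ : E → ℝ≥0∞ := (ball (0 : E) 1).indicator fun _ => 1 with hχ
  have hχm : Measurable χ := measurable_const.indicator measurableSet_ball
  -- The projection onto `ker A` along `range R`.
  set Q : F → F := fun v => v - R (T (A v)) with hQ
  have hQm : Measurable Q := measurable_id.sub (hRm.comp (hTm.comp hAm))
  have hI : Measurable fun v => χ (A v) * g (Q v) := (hχm.comp hAm).mul (hg.comp hQm)
  have h1 : ∫⁻ v, χ (A v) * g (Q v) =
      ENNReal.ofReal |(LinearMap.det (A ∘ₗ R.toLinearMap))⁻¹| * B * ∫⁻ w : K, g (Q w) := by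
    rw [lintegral_eq_lintegral_orthogonal K R hR hI, lintegral_lintegral_swap]
    · have : ∀ (w : K) (p : E), χ (A (R p + w)) * g (Q (R p + w)) =
          χ ((A ∘ₗ R.toLinearMap) p + A w) * g (Q w) := by
        intro w p
        have hq : Q (R p + w) = Q w := by
          simp only [hQ, map_add, hTl]
          abel
        rw [hq, map_add]
        rfl
      simp_rw [this]
      have : ∀ w : K, ∫⁻ p : E, χ ((A ∘ₗ R.toLinearMap) p + A w) * g (Q w) =
          ENNReal.ofReal |(LinearMap.det (A ∘ₗ R.toLinearMap))⁻¹| * B * g (Q w) := by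
        intro w
        rw [lintegral_mul_const, lintegral_indicator_ball_linear _ hdet]
        exact hχm.comp
          (((LinearMap.continuous_of_finiteDimensional _).measurable).add_const _)
      simp_rw [this]
      rw [lintegral_const_mul]
      exact hg.comp (hQm.comp measurable_subtype_coe)
    · exact (hI.comp ((hRm.comp measurable_fst).add
        (measurable_subtype_coe.comp measurable_snd))).aemeasurable
  have h2 : ∫⁻ v, χ (A v) * g (Q v) =
      ENNReal.ofReal |(LinearMap.det (A ∘ₗ S.toLinearMap))⁻¹| * B *
        ∫⁻ k : LinearMap.ker A, g k := by
    rw [lintegral_eq_lintegral_orthogonal (LinearMap.ker A) S hS hI]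
    have hQmem : ∀ v, Q v ∈ LinearMap.ker A := by
      intro v
      simp [hQ, hT]
    have : ∀ p : E, ∫⁻ k : LinearMap.ker A, χ (A (S p + k)) * g (Q (S p + k)) =
        χ ((A ∘ₗ S.toLinearMap) p + 0) * ∫⁻ k : LinearMap.ker A, g k := by
      intro p
      -- On `ker A` the projection is the identity, so on a slice `S p + ker A` it is a translation,
      -- which does not change the integral.
      have h3 : ∀ k : LinearMap.ker A, χ (A (S p + k)) * g (Q (S p + k)) =
          χ ((A ∘ₗ S.toLinearMap) p + 0) *
            g ((k + (⟨Q (S p), hQmem _⟩ : LinearMap.ker A) : LinearMap.ker A) : F) := by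
        intro k
        have hk : A k = 0 := k.2
        have hq : Q (S p + k) = k + Q (S p) := by
          simp only [hQ, map_add, hk, add_zero]
          abel
        rw [hq, map_add, hk]
        rfl
      have h4 : Measurable fun k : LinearMap.ker A =>
          g ((k + (⟨Q (S p), hQmem _⟩ : LinearMap.ker A) : LinearMap.ker A) : F) :=
        hg.comp (measurable_subtype_coe.comp (measurable_add_const _))
      simp_rw [h3]
      rw [lintegral_const_mul _ h4]
      congr 1
      exact lintegral_add_right_eq_self (fun k : LinearMap.ker A => g k) _
    simp_rw [this]
    rw [lintegral_mul_const, lintegral_indicator_ball_linear _ hSdet]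
    exact hχm.comp
      (((LinearMap.continuous_of_finiteDimensional _).measurable).add_const _)
  rw [jacobian_adjoint_eq_abs_det A S hS, ← abs_inv, ← abs_inv]
  have h4 := h1.symm.trans h2
  rw [mul_comm _ B, mul_comm _ B, mul_assoc, mul_assoc] at h4
  exact (ENNReal.mul_right_inj hB0 hBt).1 h4

end Complement

/-! ### The number of zeros of a linear family of vector fields -/

/-- The matrix is block upper triangular with an identity block for `F`. Hence the Jacobian
determinant of `(y, w) ↦ (G(y, w), w)` is that of `G` in `y` alone. -/
theorem det_prod_snd {E F : Type*} [NormedAddCommGroup E] [NormedSpace ℝ E]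
    [FiniteDimensional ℝ E] [NormedAddCommGroup F] [NormedSpace ℝ F] [FiniteDimensional ℝ F]
    (L : E × F →L[ℝ] E) :
    (L.prod (ContinuousLinearMap.snd ℝ E F)).det =
      (L.comp (ContinuousLinearMap.inl ℝ E F)).det := by
  let b := Module.finBasis ℝ E
  let c := Module.finBasis ℝ F
  rw [ContinuousLinearMap.det, ContinuousLinearMap.det, ← LinearMap.det_toMatrix (b.prod c),
    ← LinearMap.det_toMatrix b]
  have : LinearMap.toMatrix (b.prod c) (b.prod c)
      (L.prod (ContinuousLinearMap.snd ℝ E F) : E × F →ₗ[ℝ] E × F) =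
      Matrix.fromBlocks
        (LinearMap.toMatrix b b (L.comp (ContinuousLinearMap.inl ℝ E F) : E →ₗ[ℝ] E))
        (LinearMap.toMatrix c b (L.comp (ContinuousLinearMap.inr ℝ E F) : F →ₗ[ℝ] E)) 0 1 := by
    ext i j
    rcases i with i | i <;> rcases j with j | j <;>
      simp [LinearMap.toMatrix_apply, Matrix.one_apply, Finsupp.single_apply, eq_comm]
  rw [this, Matrix.det_fromBlocks_zero₂₁, Matrix.det_one, mul_one]

section Local

variable {E F : Type*} [NormedAddCommGroup E] [InnerProductSpace ℝ E] [FiniteDimensional ℝ E]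
  [NormedAddCommGroup F] [InnerProductSpace ℝ F]

/-- The solution `p` of the equation `A y (R p + w) = 0`. -/
def graphSolution (A : E → F →L[ℝ] E) (R : E →ₗᵢ[ℝ] F) (K : Submodule ℝ F) (z : E × K) : E :=
  -((A z.1).comp R.toContinuousLinearMap).inverse (A z.1 z.2)

variable {A : E → F →L[ℝ] E} {R : E →ₗᵢ[ℝ] F} {K : Submodule ℝ F} {y : E}

theorem inverse_apply_self (hy : ((A y).comp R.toContinuousLinearMap).det ≠ 0) (p : E) :
    ((A y).comp R.toContinuousLinearMap).inverse (A y (R p)) = p := by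
  have : CompleteSpace E := FiniteDimensional.complete ℝ E
  have h : ((A y).comp R.toContinuousLinearMap) =
    (((A y).comp R.toContinuousLinearMap).toContinuousLinearEquivOfDetNeZero hy : E →L[ℝ] E) := by
    ext; simp
  have h1 : A y (R p) = ((A y).comp R.toContinuousLinearMap) p := rfl
  rw [h1, h, ContinuousLinearMap.inverse_equiv]
  exact ContinuousLinearEquiv.symm_apply_apply _ _

theorem apply_inverse_self (hy : ((A y).comp R.toContinuousLinearMap).det ≠ 0) (p : E) :
    A y (R (((A y).comp R.toContinuousLinearMap).inverse p)) = p := by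
  have : CompleteSpace E := FiniteDimensional.complete ℝ E
  have h : ((A y).comp R.toContinuousLinearMap) =
    (((A y).comp R.toContinuousLinearMap).toContinuousLinearEquivOfDetNeZero hy : E →L[ℝ] E) := by
    ext; simp
  have h1 : ∀ q, A y (R q) = ((A y).comp R.toContinuousLinearMap) q := fun q => rfl
  rw [h1, h, ContinuousLinearMap.inverse_equiv]
  exact ContinuousLinearEquiv.apply_symm_apply _ _

theorem apply_graphSolution (hy : ((A y).comp R.toContinuousLinearMap).det ≠ 0) (w : K) :
    A y (R (graphSolution A R K (y, w)) + w) = 0 := by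
  rw [graphSolution, map_neg, map_add, map_neg, apply_inverse_self hy, neg_add_cancel]

theorem apply_eq_zero_iff_graphSolution (hy : ((A y).comp R.toContinuousLinearMap).det ≠ 0)
    (w : K) (p : E) : A y (R p + w) = 0 ↔ graphSolution A R K (y, w) = p := by
  constructor
  · intro h
    rw [map_add, add_comm, add_eq_zero_iff_eq_neg] at h
    rw [graphSolution, h, map_neg, neg_neg, inverse_apply_self hy]
  · rintro rfl
    exact apply_graphSolution hy w

theorem contDiffAt_graphSolution (hA : ContDiffAt ℝ 1 A y)
    (hy : ((A y).comp R.toContinuousLinearMap).det ≠ 0) (w : K) :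
    ContDiffAt ℝ 1 (graphSolution A R K) (y, w) := by
  have : CompleteSpace E := FiniteDimensional.complete ℝ E
  have h1 : ContDiffAt ℝ 1 (fun z : E × K => A z.1) (y, w) :=
    ContDiffAt.comp (y, w) (f := Prod.fst) (g := A) hA contDiffAt_fst
  have h2 : ContDiffAt ℝ 1 (fun z : E × K => (A z.1).comp R.toContinuousLinearMap) (y, w) :=
    h1.clm_comp contDiffAt_const
  have h3 : ContDiffAt ℝ 1 ContinuousLinearMap.inverse ((A y).comp R.toContinuousLinearMap) := by
    have h := contDiffAt_map_inverse (𝕜 := ℝ) (n := 1)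
      (((A y).comp R.toContinuousLinearMap).toContinuousLinearEquivOfDetNeZero hy)
    rwa [ContinuousLinearMap.coe_toContinuousLinearEquivOfDetNeZero] at h
  have h4 : ContDiffAt ℝ 1 (fun z : E × K => ((z.2 : K) : F)) (y, w) :=
    K.subtypeL.contDiff.contDiffAt.comp _ contDiffAt_snd
  exact ((h3.comp (y, w) h2).clm_apply (h1.clm_apply h4)).neg

/-- Differentiating `A x (R (G(x, w)) + w) = 0` in `x` at `y` gives `A_y R ∘ ∂_y G = -(∂_y A) v`
with `v = R (G(y, w)) + w`; take determinants. -/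
theorem abs_det_fderiv_graphSolution (hA : ∀ᶠ x in nhds y, ContDiffAt ℝ 1 A x)
    (hy : ∀ᶠ x in nhds y, ((A x).comp R.toContinuousLinearMap).det ≠ 0) (w : K) :
    |((fderiv ℝ (graphSolution A R K) (y, w)).comp (ContinuousLinearMap.inl ℝ E K)).det| =
      |((A y).comp R.toContinuousLinearMap).det|⁻¹ *
        |((fderiv ℝ A y).flip (R (graphSolution A R K (y, w)) + w)).det| := by
  set D := (fderiv ℝ (graphSolution A R K) (y, w)).comp (ContinuousLinearMap.inl ℝ E K) with hD
  have hG : HasFDerivAt (fun x => graphSolution A R K (x, w)) D y := by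
    have h1 := ((contDiffAt_graphSolution (K := K) hA.self_of_nhds hy.self_of_nhds
      w).differentiableAt one_ne_zero).hasFDerivAt
    exact HasFDerivAt.comp (f := fun x => (x, w)) y h1 (hasFDerivAt_prodMk_left y w)
  have hG' : HasFDerivAt (fun x => R (graphSolution A R K (x, w)) + (w : F))
      (R.toContinuousLinearMap.comp D) y :=
    (R.toContinuousLinearMap.hasFDerivAt.comp y hG).add_const _
  have hAd : HasFDerivAt A (fderiv ℝ A y) y :=
    (hA.self_of_nhds.differentiableAt one_ne_zero).hasFDerivAt
  have h0 := hAd.clm_apply hG'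
  have hz : (fun x => A x (R (graphSolution A R K (x, w)) + (w : F))) =ᶠ[nhds y] fun _ => 0 := by
    filter_upwards [hy] with x hx using apply_graphSolution hx w
  have h1 := h0.unique ((hasFDerivAt_const (0 : E) y).congr_of_eventuallyEq hz)
  have h2 : ((A y).comp R.toContinuousLinearMap).comp D =
      -((fderiv ℝ A y).flip (R (graphSolution A R K (y, w)) + w)) := by
    rw [eq_neg_iff_add_eq_zero]
    exact h1
  have h3 := congrArg (fun L : E →L[ℝ] E => |L.det|) h2
  have h4 : ∀ L L' : E →L[ℝ] E, (L.comp L').det = L.det * L'.det := fun L L' =>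
    LinearMap.det_comp (L : E →ₗ[ℝ] E) L'
  have h5 : ∀ L : E →L[ℝ] E, |(-L).det| = |L.det| := by
    intro L
    have : -L = (-1 : ℝ) • L := by simp
    rw [this, ContinuousLinearMap.det, ContinuousLinearMap.toLinearMap_smul, LinearMap.det_smul,
      abs_mul, abs_pow]
    simp
  simp only [h4, h5, abs_mul] at h3
  rw [← h3, ← mul_assoc, inv_mul_cancel₀ (abs_ne_zero.2 hy.self_of_nhds), one_mul]

theorem fderiv_graph (hA : ContDiffAt ℝ 1 A y)
    (hy : ((A y).comp R.toContinuousLinearMap).det ≠ 0) (w : K) :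
    HasFDerivAt (fun z : E × K => (graphSolution A R K z, z.2))
      ((fderiv ℝ (graphSolution A R K) (y, w)).prod (ContinuousLinearMap.snd ℝ E K)) (y, w) :=
  ((contDiffAt_graphSolution hA hy w).differentiableAt one_ne_zero).hasFDerivAt.prodMk
    hasFDerivAt_snd

variable [FiniteDimensional ℝ F] [MeasurableSpace F] [BorelSpace F]

/-- The density at `y` of the expected number of zeros of the random vector field `A · v`, where
`v` is a random element of the unit ball of `F`. -/
def zeroDensity (A : E → F →L[ℝ] E) (y : E) : ℝ≥0∞ :=
  ENNReal.ofReal (jacobian (LinearMap.adjoint (A y : F →ₗ[ℝ] E)))⁻¹ *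
    ∫⁻ v : LinearMap.ker (A y : F →ₗ[ℝ] E),
      ENNReal.ofReal |((fderiv ℝ A y).flip (v : F)).det| *
        (ball (0 : F) 1).indicator (fun _ => 1) (v : F)

variable [MeasurableSpace E] [BorelSpace E]

/-- `R (G(y, w)) + w` is the projection of `w` onto `ker A_y` along `range R`, so
`lintegral_oblique` replaces `|det A_y R|⁻¹` and `K` by quantities that depend neither on `R` nor on
`K`. -/
theorem lintegral_graphSolution_eq_zeroDensity (hA : ∀ᶠ x in nhds y, ContDiffAt ℝ 1 A x)
    (hs : Function.Surjective (A y)) (hR : LinearMap.range R.toLinearMap = Kᗮ)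
    (hy : ∀ᶠ x in nhds y, ((A x).comp R.toContinuousLinearMap).det ≠ 0) :
    ∫⁻ w : K, ENNReal.ofReal
        |((fderiv ℝ (graphSolution A R K) (y, w)).comp (ContinuousLinearMap.inl ℝ E K)).det| *
        (ball (0 : F) 1).indicator (fun _ => 1) (R (graphSolution A R K (y, w)) + w) =
      zeroDensity A y := by
  have hy0 := hy.self_of_nhds
  let g : F → ℝ≥0∞ := fun v => ENNReal.ofReal |((fderiv ℝ A y).flip v).det| *
        (ball (0 : F) 1).indicator (fun _ => 1) v
  have hm : Measurable g := by
    refine Measurable.mul ?_ (measurable_const.indicator measurableSet_ball)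
    exact ((ContinuousLinearMap.continuous_det.comp
      (fderiv ℝ A y).flip.continuous).abs.measurable).ennreal_ofReal
  have key := lintegral_oblique (A y : F →ₗ[ℝ] E) hs K R hR
    (((A y).comp R.toContinuousLinearMap).inverse : E →ₗ[ℝ] E) (apply_inverse_self hy0) hm
  rw [zeroDensity, ← key, ← lintegral_const_mul]
  · refine lintegral_congr fun w => ?_
    rw [abs_det_fderiv_graphSolution hA hy w, ENNReal.ofReal_mul (by positivity), mul_assoc]
    have : R (graphSolution A R K (y, w)) + (w : F) =
        w - R (((A y).comp R.toContinuousLinearMap).inverse (A y w)) := by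
      rw [graphSolution, map_neg]
      abel
    rw [this]
    rfl
  · refine hm.comp ?_
    exact Continuous.measurable (by fun_prop)

/-- The local form of the theorem. On a ball where `A y ∘ R` stays invertible, zeros of `A · v` are
fibres of the graph map `Φ`; the area formula for `Φ` and Fubini in `(y, w)` give the identity. -/
theorem exists_ball_lintegral_zeros {U : Set E} (hU : IsOpen U) (hA : ContDiffOn ℝ 1 A U)
    (hs : ∀ y ∈ U, Function.Surjective (A y)) {y₀ : E} (hy₀ : y₀ ∈ U) :
    ∃ r > 0, ball y₀ r ⊆ U ∧ ∀ W ⊆ ball y₀ r, MeasurableSet W →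
      AEMeasurable (fun v => (({y ∈ W | A y v = 0}.encard : ℕ∞) : ℝ≥0∞)) volume ∧
      ∫⁻ v in ball (0 : F) 1, ({y ∈ W | A y v = 0}.encard : ℝ≥0∞) = ∫⁻ y in W, zeroDensity A y ∧
      AEMeasurable (zeroDensity A) (volume.restrict W) ∧ ∫⁻ y in W, zeroDensity A y < ⊤ := by
  have hcd : ∀ y ∈ U, ContDiffAt ℝ 1 A y := fun y hy => hA.contDiffAt (hU.mem_nhds hy)
  obtain ⟨R, hR⟩ := exists_isometry_range_eq_orthogonal_ker (A y₀ : F →ₗ[ℝ] E) (hs y₀ hy₀)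
  set K : Submodule ℝ F := LinearMap.ker (A y₀ : F →ₗ[ℝ] E) with hK
  have hdet₀ : ((A y₀).comp R.toContinuousLinearMap).det ≠ 0 := by
    intro h0
    obtain ⟨p, hp, hp0⟩ := SetLike.exists_of_lt (LinearMap.bot_lt_ker_of_det_eq_zero h0)
    have h1 : R p ∈ K := hp
    have h2 : R p ∈ Kᗮ := hR ▸ ⟨p, rfl⟩
    have h3 : R p = 0 := inner_self_eq_zero.1 (Submodule.inner_right_of_mem_orthogonal h1 h2)
    exact hp0 ((Submodule.mem_bot ℝ).2 (R.injective (h3.trans (map_zero R).symm)))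
  have hcont : ∀ y ∈ U, ContinuousAt (fun x => ((A x).comp R.toContinuousLinearMap).det) y := by
    intro y hy
    refine ContinuousLinearMap.continuous_det.continuousAt.comp ?_
    exact (hcd y hy).continuousAt.clm_comp continuousAt_const
  have hnear : ∀ᶠ y in nhds y₀, y ∈ U ∧ ((A y).comp R.toContinuousLinearMap).det ≠ 0 :=
    (hU.eventually_mem hy₀).and ((hcont y₀ hy₀).eventually_ne hdet₀)
  obtain ⟨r', hr', hsub⟩ := Metric.eventually_nhds_iff_ball.1 hnear
  have hgood : ∀ y ∈ ball y₀ r', (∀ᶠ x in nhds y, ContDiffAt ℝ 1 A x) ∧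
      ∀ᶠ x in nhds y, ((A x).comp R.toContinuousLinearMap).det ≠ 0 := by
    intro y hy
    have := isOpen_ball.mem_nhds hy
    exact ⟨by filter_upwards [this] with x hx using hcd x (hsub x hx).1,
      by filter_upwards [this] with x hx using (hsub x hx).2⟩
  -- With half the radius the closed ball still lies in the good region; its compactness gives the
  -- bound on the density at the end.
  refine ⟨r' / 2, half_pos hr', fun y hy => (hsub y (ball_subset_ball (by linarith) hy)).1, ?_⟩
  intro W hW hWm
  have hW' : W ⊆ ball y₀ r' := hW.trans (ball_subset_ball (by linarith))
  set G : E × K → E := graphSolution A R K with hG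
  set Φ : E × K → E × K := fun z => (G z, z.2) with hΦ
  have hΦd : ∀ z ∈ W ×ˢ (Set.univ : Set K),
      HasFDerivAt Φ ((fderiv ℝ G z).prod (ContinuousLinearMap.snd ℝ E K)) z := by
    rintro ⟨y, w⟩ ⟨hy, -⟩
    exact fderiv_graph (hgood y (hW' hy)).1.self_of_nhds (hgood y (hW' hy)).2.self_of_nhds w
  have hΦdet : ∀ z ∈ W ×ˢ (Set.univ : Set K), (fderiv ℝ Φ z).det =
      ((fderiv ℝ G z).comp (ContinuousLinearMap.inl ℝ E K)).det := by
    intro z hz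
    rw [(hΦd z hz).fderiv, det_prod_snd]
  have hWK : MeasurableSet (W ×ˢ (Set.univ : Set K)) := hWm.prod MeasurableSet.univ
  have hHaar : (volume : Measure (E × K)).IsAddHaarMeasure :=
    inferInstanceAs ((volume : Measure E).prod (volume : Measure K)).IsAddHaarMeasure
  obtain ⟨ham, haf⟩ := area_formula (volume : Measure (E × K)) hWK
    fun z hz => (hΦd z hz).differentiableAt
  obtain ⟨e, he, heq⟩ := exists_measurePreserving_orthogonal K R hR
  -- The fibre of `Φ` over `(p, w)` is the zero set of `A · (R p + w)` in `W`, paired with the fixed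
  -- second coordinate `w`.
  have hcount : ∀ z : E × K, {y ∈ W | A y (e z) = 0}.encard =
      ((W ×ˢ (Set.univ : Set K)) ∩ Φ ⁻¹' {z}).encard := by
    rintro ⟨p, w⟩
    rw [← (Prod.mk_left_injective w).encard_image {y ∈ W | A y (e (p, w)) = 0}]
    congr 1
    ext ⟨y, w'⟩
    simp only [Set.mem_image, Set.mem_ofPred_eq, Prod.mk.injEq, Set.mem_inter_iff, Set.mem_prod,
      Set.mem_univ, and_true, Set.mem_preimage, Set.mem_singleton_iff, heq, hΦ]
    constructor
    · rintro ⟨y', ⟨hy', h0⟩, rfl, rfl⟩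
      refine ⟨hy', ?_, rfl⟩
      exact (apply_eq_zero_iff_graphSolution (hgood y' (hW' hy')).2.self_of_nhds w p).1 h0
    · rintro ⟨hy', h0, rfl⟩
      refine ⟨y, ⟨hy', ?_⟩, rfl, rfl⟩
      exact (apply_eq_zero_iff_graphSolution (hgood y (hW' hy')).2.self_of_nhds w' p).2 h0
  have hcm : AEMeasurable (fun v => (({y ∈ W | A y v = 0}.encard : ℕ∞) : ℝ≥0∞)) volume := by
    rw [← he.aemeasurable_comp_iff e.measurableEmbedding]
    refine ham.congr (Filter.Eventually.of_forall fun z => ?_)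
    simp only [Function.comp_apply, hcount]
  set χ : F → ℝ≥0∞ := (ball (0 : F) 1).indicator fun _ => 1 with hχ
  have hχm : Measurable χ := measurable_const.indicator measurableSet_ball
  set I : E × K → ℝ≥0∞ := fun z => ENNReal.ofReal |(fderiv ℝ Φ z).det| * χ (e (Φ z)) with hI
  have hIeq : ∀ y ∈ W, ∫⁻ w : K, I (y, w) = zeroDensity A y := by
    intro y hy
    rw [← lintegral_graphSolution_eq_zeroDensity (hgood y (hW' hy)).1 (hs y (hsub y (hW' hy)).1)
      hR (hgood y (hW' hy)).2]
    refine lintegral_congr fun w => ?_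
    rw [hI]
    simp only [hΦdet (y, w) ⟨hy, trivial⟩, heq]
    rfl
  have hIm : AEMeasurable I ((volume.restrict W).prod (volume : Measure K)) := by
    have : (volume.restrict W).prod (volume : Measure K) =
        (volume : Measure (E × K)).restrict (W ×ˢ Set.univ) := by
      rw [Measure.volume_eq_prod, ← Measure.prod_restrict, Measure.restrict_univ]
    rw [this]
    refine AEMeasurable.mul ?_ ?_
    · exact (ContinuousLinearMap.continuous_det.measurable.comp
        (measurable_fderiv ℝ Φ)).abs.ennreal_ofReal.aemeasurable
    · refine (hχm.comp e.measurable).comp_aemeasurable ?_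
      exact ContinuousOn.aemeasurable
        (fun z hz => (hΦd z hz).continuousAt.continuousWithinAt) hWK
  have hformula : ∫⁻ v in ball (0 : F) 1, ({y ∈ W | A y v = 0}.encard : ℝ≥0∞) =
      ∫⁻ y in W, zeroDensity A y := by
    calc ∫⁻ v in ball (0 : F) 1, ({y ∈ W | A y v = 0}.encard : ℝ≥0∞)
        = ∫⁻ v, ({y ∈ W | A y v = 0}.encard : ℝ≥0∞) * χ v := by
          rw [← lintegral_indicator measurableSet_ball]
          refine lintegral_congr fun v => ?_
          by_cases hv : v ∈ ball (0 : F) 1 <;> simp only [hχ, Set.indicator, hv] <;> simp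
      _ = ∫⁻ z, (((W ×ˢ (Set.univ : Set K)) ∩ Φ ⁻¹' {z}).encard : ℝ≥0∞) * χ (e z) := by
          rw [← he.lintegral_comp_emb e.measurableEmbedding]
          simp_rw [hcount]
      _ = ∫⁻ z in W ×ˢ (Set.univ : Set K), I z := haf (χ ∘ e) (hχm.comp e.measurable)
      _ = ∫⁻ y in W, ∫⁻ w : K, I (y, w) := by
          rw [Measure.volume_eq_prod, ← Measure.prod_restrict, Measure.restrict_univ,
            lintegral_prod I hIm]
      _ = ∫⁻ y in W, zeroDensity A y := setLIntegral_congr_fun hWm hIeq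
  refine ⟨hcm, hformula, ?_, ?_⟩
  · refine hIm.lintegral_prod_right'.congr ?_
    filter_upwards [ae_restrict_mem hWm] with y hy using hIeq y hy
  -- Only `‖w‖ ≤ 1` matters in the integral over `K`: `R p` is orthogonal to `w`, so `‖w‖ ≤ ‖R p +
  -- w‖`, and the ball indicator vanishes otherwise. The Jacobian is bounded on the compact set `C`.
  · set C : Set (E × K) := closedBall y₀ (r' / 2) ×ˢ closedBall (0 : K) 1 with hC
    have hCc : IsCompact C := by
      have : ProperSpace E := FiniteDimensional.proper ℝ E
      have : ProperSpace K := FiniteDimensional.proper ℝ K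
      exact (isCompact_closedBall _ _).prod (isCompact_closedBall _ _)
    have hCb : ContinuousOn
        (fun z => |((fderiv ℝ G z).comp (ContinuousLinearMap.inl ℝ E K)).det|) C := by
      rintro ⟨y, w⟩ ⟨hy, -⟩
      have hyr : y ∈ ball y₀ r' := closedBall_subset_ball (by linarith) hy
      have h1 := contDiffAt_graphSolution (K := K) (hgood y hyr).1.self_of_nhds
        (hgood y hyr).2.self_of_nhds w
      have h2 : ContinuousAt (fderiv ℝ G) (y, w) := (h1.fderiv_right (m := 0) le_rfl).continuousAt
      exact ((ContinuousLinearMap.continuous_det.continuousAt.comp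
        (h2.clm_comp continuousAt_const)).abs).continuousWithinAt
    obtain ⟨b, hb⟩ := hCc.bddAbove_image hCb
    have hbound : ∀ y ∈ W, zeroDensity A y ≤ ENNReal.ofReal b * volume (closedBall (0 : K) 1) := by
      intro y hy
      rw [← hIeq y hy, ← setLIntegral_const, ← lintegral_indicator measurableSet_closedBall]
      refine lintegral_mono fun w => ?_
      by_cases hw : w ∈ closedBall (0 : K) 1
      · rw [Set.indicator_of_mem hw, hI]
        refine (mul_le_mul' le_rfl (Set.indicator_le_self' (fun _ _ => zero_le) _)).trans ?_
        rw [mul_one]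
        refine ENNReal.ofReal_le_ofReal ?_
        rw [hΦdet (y, w) ⟨hy, trivial⟩]
        exact hb ⟨(y, w), ⟨ball_subset_closedBall (hW hy), hw⟩, rfl⟩
      · have : e (Φ (y, w)) ∉ ball (0 : F) 1 := by
          intro h
          apply hw
          rw [mem_closedBall_zero_iff]
          rw [mem_ball_zero_iff, heq] at h
          have horth : ⟪R (Φ (y, w)).1, (w : F)⟫_ℝ = 0 := by
            have : R (Φ (y, w)).1 ∈ Kᗮ := hR ▸ ⟨_, rfl⟩
            exact Submodule.inner_left_of_mem_orthogonal w.2 this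
          have h3 := norm_add_sq_eq_norm_sq_add_norm_sq_real horth
          have h4 : ‖w‖ ≤ ‖R (Φ (y, w)).1 + (w : F)‖ := by
            rw [Submodule.coe_norm]
            refine abs_le_of_sq_le_sq' ?_ (norm_nonneg _) |>.2
            nlinarith [norm_nonneg (R (Φ (y, w)).1)]
          exact h4.trans h.le
        rw [hI]
        simp only [hχ, Set.indicator_of_notMem this, mul_zero]
        exact zero_le
    calc ∫⁻ y in W, zeroDensity A y
        ≤ ∫⁻ _ in W, ENNReal.ofReal b * volume (closedBall (0 : K) 1) :=
          setLIntegral_mono' hWm hbound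
      _ = ENNReal.ofReal b * volume (closedBall (0 : K) 1) * volume W := setLIntegral_const _ _
      _ < ⊤ := ENNReal.mul_lt_top
          (ENNReal.mul_lt_top ENNReal.ofReal_lt_top measure_closedBall_lt_top)
          ((measure_mono hW).trans_lt measure_ball_lt_top)

end Local

/-! ### Homogeneous functions in polar coordinates -/

section Polar

variable {E : Type*} [NormedAddCommGroup E] [InnerProductSpace ℝ E]

theorem homeomorphUnitSphereProd_smul (x : ({0}ᶜ : Set E)) :
    (x : E) = ((homeomorphUnitSphereProd E x).2 : ℝ) • ((homeomorphUnitSphereProd E x).1 : E) := by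
  have h := (homeomorphUnitSphereProd E).symm_apply_apply x
  conv_lhs => rw [← h]
  rfl

theorem norm_eq_homeomorphUnitSphereProd (x : ({0}ᶜ : Set E)) :
    ‖(x : E)‖ = ((homeomorphUnitSphereProd E x).2 : ℝ) := by
  rw [homeomorphUnitSphereProd_smul x, norm_smul, norm_eq_of_mem_sphere, mul_one,
    Real.norm_of_nonneg (homeomorphUnitSphereProd E x).2.2.le]

variable [FiniteDimensional ℝ E] [MeasurableSpace E] [BorelSpace E]

/-- `Measure.volumeIoiPow n` is `rⁿ dr`, so this is `∫₀¹ rⁿ⁺ᵐ dr`, the radial factor in polar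
coordinates. -/
theorem lintegral_pow_volumeIoiPow (n m : ℕ) :
    ∫⁻ r : Set.Ioi (0 : ℝ), (Set.Iio (⟨1, Set.mem_Ioi.2 one_pos⟩ : Set.Ioi (0 : ℝ))).indicator
      (fun r => ENNReal.ofReal (r.1 ^ m)) r ∂(Measure.volumeIoiPow n) =
      ((n + m + 1 : ℕ) : ℝ≥0∞)⁻¹ := by
  have h1 : ∀ k : ℕ, Measurable fun r : Set.Ioi (0 : ℝ) => ENNReal.ofReal (r.1 ^ k) := fun k =>
    (measurable_subtype_coe.pow_const k).ennreal_ofReal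
  have h := Measure.volumeIoiPow_apply_Iio (n + m) ⟨1, Set.mem_Ioi.2 one_pos⟩
  rw [lintegral_indicator measurableSet_Iio, Measure.volumeIoiPow,
    setLIntegral_withDensity_eq_setLIntegral_mul _ (h1 n) (h1 m) measurableSet_Iio]
  rw [Measure.volumeIoiPow, withDensity_apply _ measurableSet_Iio] at h
  have h2 : ∀ r : Set.Ioi (0 : ℝ), ((fun r : Set.Ioi (0 : ℝ) => ENNReal.ofReal (r.1 ^ n)) *
      fun r : Set.Ioi (0 : ℝ) => ENNReal.ofReal (r.1 ^ m)) r = ENNReal.ofReal (r.1 ^ (n + m)) := by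
    intro r
    rw [Pi.mul_apply, ← ENNReal.ofReal_mul (pow_nonneg r.2.le _), pow_add]
  simp_rw [h2]
  rw [h, one_pow, one_div, ENNReal.ofReal_inv_of_pos (by positivity)]
  congr 1
  rw [← ENNReal.ofReal_natCast]
  push_cast
  rfl

/-- In polar coordinates `φ` depends on the direction only. A measurable function that agrees with
it almost everywhere on the product agrees with it on almost every sphere; one good radius suffices,
and it exists because the radial measure is nonzero. -/
theorem aemeasurable_sphere_of_homogeneous [Nontrivial E] {φ : E → ℝ≥0∞}
    (hφ : ∀ r : ℝ, 0 < r → ∀ v, φ (r • v) = φ v) (hm : AEMeasurable φ volume) :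
    AEMeasurable (fun s : sphere (0 : E) 1 => φ s) (sphereArea E) := by
  have hp := (volume : Measure E).measurePreserving_homeomorphUnitSphereProd
  have h1 : AEMeasurable (fun x : ({0}ᶜ : Set E) => φ x) (Measure.comap Subtype.val volume) := by
    have he : MeasurableEmbedding (Subtype.val : ({0}ᶜ : Set E) → E) :=
      MeasurableEmbedding.subtype_coe (measurableSet_singleton (0 : E)).compl
    refine (he.aemeasurable_map_iff (g := φ)).1 ?_
    rw [he.map_comap]
    exact hm.mono_measure Measure.restrict_le_self
  have h2 : AEMeasurable (fun z : sphere (0 : E) 1 × Set.Ioi (0 : ℝ) => φ z.1)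
      ((volume : Measure E).toSphere.prod
        (Measure.volumeIoiPow (Module.finrank ℝ E - 1))) := by
    rw [← hp.aemeasurable_comp_iff (homeomorphUnitSphereProd E).measurableEmbedding]
    refine h1.congr (Filter.Eventually.of_forall fun x => ?_)
    simp only [Function.comp_apply]
    conv_lhs => rw [homeomorphUnitSphereProd_smul x]
    exact hφ _ (homeomorphUnitSphereProd E x).2.2 _
  have h3 : AEMeasurable (fun z : Set.Ioi (0 : ℝ) × sphere (0 : E) 1 => φ z.2)
      ((Measure.volumeIoiPow (Module.finrank ℝ E - 1)).prod (volume : Measure E).toSphere) :=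
    h2.comp_quasiMeasurePreserving Measure.measurePreserving_swap.quasiMeasurePreserving
  obtain ⟨g, hg, hgφ⟩ := h3
  have h4 := Measure.ae_ae_of_ae_prod hgφ
  have h5 : NeZero (Measure.volumeIoiPow (Module.finrank ℝ E - 1)) := by
    refine ⟨fun h0 => ?_⟩
    have := Measure.volumeIoiPow_apply_Iio (Module.finrank ℝ E - 1) ⟨1, Set.mem_Ioi.2 one_pos⟩
    rw [h0, Measure.coe_zero, Pi.zero_apply, eq_comm, ENNReal.ofReal_eq_zero] at this
    refine absurd this (not_le.2 ?_)
    positivity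
  obtain ⟨r, hr⟩ := h4.exists
  exact ⟨fun s => g (r, s), hg.comp measurable_prodMk_left, hr⟩

/-- In dimension `n` the radial integral over the unit ball is `∫₀¹ rⁿ⁻¹⁺ᵐ dr = 1 / (n + m)`. -/
theorem lintegral_sphere_of_homogeneous [Nontrivial E] (m : ℕ) {φ : E → ℝ≥0∞}
    (hφ : ∀ r : ℝ, 0 < r → ∀ v, φ (r • v) = ENNReal.ofReal (r ^ m) * φ v)
    (hm : AEMeasurable (fun s : sphere (0 : E) 1 => φ s) (sphereArea E)) :
    ∫⁻ s : sphere (0 : E) 1, φ s ∂(sphereArea E) =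
      ((Module.finrank ℝ E + m : ℕ) : ℝ≥0∞) * ∫⁻ v in ball (0 : E) 1, φ v := by
  have hp := (volume : Measure E).measurePreserving_homeomorphUnitSphereProd
  have he : MeasurableEmbedding (Subtype.val : ({0}ᶜ : Set E) → E) :=
    MeasurableEmbedding.subtype_coe (measurableSet_singleton (0 : E)).compl
  set ψ : Set.Ioi (0 : ℝ) → ℝ≥0∞ :=
    (Set.Iio (⟨1, Set.mem_Ioi.2 one_pos⟩ : Set.Ioi (0 : ℝ))).indicator
      (fun r => ENNReal.ofReal (r.1 ^ m)) with hψ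
  have hψm : Measurable ψ :=
    (measurable_subtype_coe.pow_const m).ennreal_ofReal.indicator measurableSet_Iio
  have hfin : Module.finrank ℝ E - 1 + m + 1 = Module.finrank ℝ E + m := by
    have : 0 < Module.finrank ℝ E := Module.finrank_pos
    omega
  have h1 : ∫⁻ v in ball (0 : E) 1, φ v =
      (∫⁻ s : sphere (0 : E) 1, φ s ∂(sphereArea E)) *
        ((Module.finrank ℝ E + m : ℕ) : ℝ≥0∞)⁻¹ := by
    calc ∫⁻ v in ball (0 : E) 1, φ v
        = ∫⁻ v in ({0}ᶜ : Set E), (ball (0 : E) 1).indicator φ v := by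
          rw [← lintegral_indicator measurableSet_ball, Measure.restrict_eq_self_of_ae_mem]
          exact compl_mem_ae_iff.2 (measure_singleton 0)
      _ = ∫⁻ x : ({0}ᶜ : Set E), (ball (0 : E) 1).indicator φ x
            ∂(Measure.comap Subtype.val volume) := by
          rw [← he.lintegral_map, he.map_comap, Subtype.range_coe]
      _ = ∫⁻ z : sphere (0 : E) 1 × Set.Ioi (0 : ℝ), φ z.1 * ψ z.2
            ∂((volume : Measure E).toSphere.prod
              (Measure.volumeIoiPow (Module.finrank ℝ E - 1))) := by
          rw [← hp.lintegral_comp_emb (homeomorphUnitSphereProd E).measurableEmbedding]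
          refine lintegral_congr fun x => ?_
          have hx := norm_eq_homeomorphUnitSphereProd x
          by_cases h : (x : E) ∈ ball (0 : E) 1
          · have h' : (homeomorphUnitSphereProd E x).2 ∈
                Set.Iio (⟨1, Set.mem_Ioi.2 one_pos⟩ : Set.Ioi (0 : ℝ)) := by
              rw [mem_ball_zero_iff, hx] at h
              exact h
            rw [Set.indicator_of_mem h, hψ, Set.indicator_of_mem h', mul_comm]
            conv_lhs => rw [homeomorphUnitSphereProd_smul x]
            exact hφ _ (homeomorphUnitSphereProd E x).2.2 _
          · have h' : (homeomorphUnitSphereProd E x).2 ∉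
                Set.Iio (⟨1, Set.mem_Ioi.2 one_pos⟩ : Set.Ioi (0 : ℝ)) := by
              intro h2
              apply h
              rw [mem_ball_zero_iff, hx]
              exact h2
            rw [Set.indicator_of_notMem h, hψ, Set.indicator_of_notMem h', mul_zero]
      _ = _ := by
          unfold sphereArea at hm ⊢
          rw [lintegral_prod_mul hm hψm.aemeasurable, hψ, lintegral_pow_volumeIoiPow, hfin]
  rw [h1, mul_comm, mul_assoc, ENNReal.inv_mul_cancel, mul_one]
  · rw [← hfin]
    exact Nat.cast_ne_zero.2 (Nat.succ_ne_zero _)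
  · exact ENNReal.natCast_ne_top _

/-- `n` times the volume `π^(n/2) / Γ(n/2 + 1)` of the ball, with `Γ(n/2 + 1) = (n/2) Γ(n/2)`. -/
theorem sphereArea_univ [Nontrivial E] :
    sphereArea E Set.univ = ENNReal.ofReal (sigma (Module.finrank ℝ E - 1)) := by
  have hpos : 0 < Module.finrank ℝ E := Module.finrank_pos
  have hN : (0 : ℝ) < Module.finrank ℝ E := Nat.cast_pos.2 hpos
  rw [sphereArea, Measure.toSphere_apply_univ, InnerProductSpace.volume_ball]
  rw [ENNReal.ofReal_one, one_pow, one_mul, ← ENNReal.ofReal_natCast,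
    ← ENNReal.ofReal_mul (Nat.cast_nonneg _), sigma, Nat.cast_pred hpos, sub_add_cancel]
  congr 1
  rw [Real.Gamma_add_one (by positivity), Real.sqrt_eq_rpow, ← Real.rpow_mul_natCast
    Real.pi_pos.le, one_div_mul_eq_div]
  have hΓ : Real.Gamma ((Module.finrank ℝ E : ℝ) / 2) ≠ 0 :=
    (Real.Gamma_pos_of_pos (by positivity)).ne'
  field_simp

theorem sigma_pos (n : ℕ) : 0 < sigma n := by
  have := Real.Gamma_pos_of_pos (s := ((n : ℝ) + 1) / 2) (by positivity)
  have := Real.pi_pos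
  rw [sigma]
  positivity

end Polar

/-! ### Differentials and Hessians in coordinates -/

/-- The second-order chain rule has the extra term `du (D²φ)`, which vanishes at a critical point.
This is why the Hessian is tensorial there. -/
theorem fderiv_fderiv_comp_of_fderiv_eq_zero {E F : Type*} [NormedAddCommGroup E]
    [NormedSpace ℝ E] [NormedAddCommGroup F] [NormedSpace ℝ F] {u : F → ℝ} {φ : E → F} {y : E}
    (hu : ContDiffAt ℝ 2 u (φ y)) (hφ : ContDiffAt ℝ 2 φ y) (h0 : fderiv ℝ u (φ y) = 0)
    (X Y : E) :
    fderiv ℝ (fderiv ℝ (u ∘ φ)) y X Y =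
      fderiv ℝ (fderiv ℝ u) (φ y) (fderiv ℝ φ y X) (fderiv ℝ φ y Y) := by
  have h1 : ∀ᶠ x in nhds y, fderiv ℝ (u ∘ φ) x = (fderiv ℝ u (φ x)).comp (fderiv ℝ φ x) := by
    have hu' := hφ.continuousAt.eventually (hu.eventually (by simp))
    filter_upwards [hu', hφ.eventually (by simp)] with x hx hx'
    exact fderiv_comp x (hx.differentiableAt two_ne_zero) (hx'.differentiableAt two_ne_zero)
  have hc : HasFDerivAt (fun x => fderiv ℝ u (φ x))
      ((fderiv ℝ (fderiv ℝ u) (φ y)).comp (fderiv ℝ φ y)) y := by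
    have h2 : DifferentiableAt ℝ (fderiv ℝ u) (φ y) :=
      (hu.fderiv_right (m := 1) (by norm_num)).differentiableAt one_ne_zero
    exact h2.hasFDerivAt.comp y (hφ.differentiableAt two_ne_zero).hasFDerivAt
  have hd : HasFDerivAt (fderiv ℝ φ) (fderiv ℝ (fderiv ℝ φ) y) y :=
    ((hφ.fderiv_right (m := 1) (by norm_num)).differentiableAt one_ne_zero).hasFDerivAt
  have h3 := (hc.clm_comp hd).congr_of_eventuallyEq h1
  rw [h3.fderiv]
  change fderiv ℝ u (φ y) (fderiv ℝ (fderiv ℝ φ) y X Y) +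
    fderiv ℝ (fderiv ℝ u) (φ y) (fderiv ℝ φ y X) (fderiv ℝ φ y Y) = _
  rw [h0, zero_apply, zero_add]

/-- The vector that represents a linear form on a Euclidean space. -/
def ofDual (E : Type*) [NormedAddCommGroup E] [InnerProductSpace ℝ E] [FiniteDimensional ℝ E] :
    (E →L[ℝ] ℝ) →L[ℝ] E :=
  haveI : CompleteSpace E := FiniteDimensional.complete ℝ E
  LinearMap.toContinuousLinearMap
    { toFun := fun l => (InnerProductSpace.toDual ℝ E).symm l
      map_add' := fun l l' => map_add _ l l'
      map_smul' := fun c l => by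
        refine ext_inner_right ℝ fun X => ?_
        rw [RingHom.id_apply, real_inner_smul_left, InnerProductSpace.toDual_symm_apply,
          InnerProductSpace.toDual_symm_apply]
        rfl }

theorem inner_ofDual {E : Type*} [NormedAddCommGroup E] [InnerProductSpace ℝ E]
    [FiniteDimensional ℝ E] (l : E →L[ℝ] ℝ) (X : E) : ⟪ofDual E l, X⟫_ℝ = l X :=
  haveI : CompleteSpace E := FiniteDimensional.complete ℝ E
  InnerProductSpace.toDual_symm_apply

section Manifold

variable {m : ℕ} {M : Type*} [TopologicalSpace M] [ChartedSpace (EuclideanSpace ℝ (Fin m)) M]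

theorem contDiffAt_comp_of_contMDiffAt {f : M → ℝ} (hf : ContMDiff (𝓡 m) 𝓘(ℝ, ℝ) ∞ f)
    {ψ : EuclideanSpace ℝ (Fin m) → M} {y : EuclideanSpace ℝ (Fin m)}
    (hψ : ContMDiffAt (𝓡 m) (𝓡 m) ∞ ψ y) : ContDiffAt ℝ ∞ (f ∘ ψ) y :=
  (hf.contMDiffAt.comp y hψ).contDiffAt

theorem fderiv_comp_eq_mvfderiv_comp {f : M → ℝ} (hf : ContMDiff (𝓡 m) 𝓘(ℝ, ℝ) ∞ f)
    {ψ : EuclideanSpace ℝ (Fin m) → M} {y : EuclideanSpace ℝ (Fin m)}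
    (hψ : ContMDiffAt (𝓡 m) (𝓡 m) ∞ ψ y) :
    fderiv ℝ (f ∘ ψ) y = (mvfderiv (𝓡 m) f (ψ y)).comp (mfderiv (𝓡 m) (𝓡 m) ψ y) := by
  rw [← mfderiv_eq_fderiv]
  exact mfderiv_comp y (hf.contMDiffAt.mdifferentiableAt (by simp))
    (hψ.mdifferentiableAt (by simp))

section Smooth

variable [IsManifold (𝓡 m) ∞ M]

theorem contMDiffAt_chart_symm {x : M} {y : EuclideanSpace ℝ (Fin m)}
    (hy : y ∈ (chartAt (EuclideanSpace ℝ (Fin m)) x).target) :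
    ContMDiffAt (𝓡 m) (𝓡 m) ∞ (chartAt (EuclideanSpace ℝ (Fin m)) x).symm y :=
  contMDiffOn_chart_symm.contMDiffAt
    ((chartAt (EuclideanSpace ℝ (Fin m)) x).open_target.mem_nhds hy)

theorem contMDiffAt_chart {x z : M} (hz : z ∈ (chartAt (EuclideanSpace ℝ (Fin m)) x).source) :
    ContMDiffAt (𝓡 m) (𝓡 m) ∞ (chartAt (EuclideanSpace ℝ (Fin m)) x) z :=
  contMDiffOn_chart.contMDiffAt
    ((chartAt (EuclideanSpace ℝ (Fin m)) x).open_source.mem_nhds hz)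

/-- The differential of the inverse of a chart, as an isomorphism. -/
def coordFrame (x : M) {y : EuclideanSpace ℝ (Fin m)}
    (hy : y ∈ (chartAt (EuclideanSpace ℝ (Fin m)) x).target) :
    EuclideanSpace ℝ (Fin m) ≃L[ℝ]
      TangentSpace (𝓡 m) ((chartAt (EuclideanSpace ℝ (Fin m)) x).symm y) :=
  (mdifferentiable_chart (I := 𝓡 m) x).symm.mfderiv hy

theorem coe_coordFrame (x : M) {y : EuclideanSpace ℝ (Fin m)}
    (hy : y ∈ (chartAt (EuclideanSpace ℝ (Fin m)) x).target) :
    (coordFrame x hy : EuclideanSpace ℝ (Fin m) →L[ℝ] _) =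
      mfderiv (𝓡 m) (𝓡 m) (chartAt (EuclideanSpace ℝ (Fin m)) x).symm y := rfl

/-- At a critical point the second derivative of `f` along a parametrization is the Hessian. -/
theorem fderiv_fderiv_comp_eq_hessian {f : M → ℝ} (hf : ContMDiff (𝓡 m) 𝓘(ℝ, ℝ) ∞ f)
    {ψ : EuclideanSpace ℝ (Fin m) → M} {y : EuclideanSpace ℝ (Fin m)}
    (hψ : ContMDiffAt (𝓡 m) (𝓡 m) ∞ ψ y) (h0 : mvfderiv (𝓡 m) f (ψ y) = 0)
    (X Y : EuclideanSpace ℝ (Fin m)) :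
    fderiv ℝ (fderiv ℝ (f ∘ ψ)) y X Y =
      hessian f (ψ y) (mfderiv (𝓡 m) (𝓡 m) ψ y X) (mfderiv (𝓡 m) (𝓡 m) ψ y Y) := by
  set c := chartAt (EuclideanSpace ℝ (Fin m)) (ψ y) with hc
  have hmem : ψ y ∈ c.source := mem_chart_source _ _
  have hmt : c (ψ y) ∈ c.target := c.map_source hmem
  have hcs : c.symm (c (ψ y)) = ψ y := c.left_inv hmem
  have hsymm : ContMDiffAt (𝓡 m) (𝓡 m) ∞ c.symm (c (ψ y)) := contMDiffAt_chart_symm hmt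
  have hφm : ContMDiffAt (𝓡 m) (𝓡 m) ∞ (c ∘ ψ) y := (contMDiffAt_chart hmem).comp y hψ
  have hφ : ContDiffAt ℝ ∞ (c ∘ ψ) y := hφm.contDiffAt
  have hu : ContDiffAt ℝ ∞ (f ∘ c.symm) (c (ψ y)) := contDiffAt_comp_of_contMDiffAt hf hsymm
  have hu0 : fderiv ℝ (f ∘ c.symm) (c (ψ y)) = 0 := by
    rw [fderiv_comp_eq_mvfderiv_comp hf hsymm, hcs, h0]
    exact ContinuousLinearMap.zero_comp _
  have heq : f ∘ ψ =ᶠ[nhds y] (f ∘ c.symm) ∘ (c ∘ ψ) := by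
    filter_upwards [hψ.continuousAt (c.open_source.mem_nhds hmem)] with x hx
    simp only [Function.comp_apply]
    rw [c.left_inv hx]
  have hφd : fderiv ℝ (c ∘ ψ) y =
      (mfderiv (𝓡 m) (𝓡 m) c (ψ y)).comp (mfderiv (𝓡 m) (𝓡 m) ψ y) := by
    rw [← mfderiv_eq_fderiv]
    exact mfderiv_comp y ((contMDiffAt_chart hmem).mdifferentiableAt (by simp))
      (hψ.mdifferentiableAt (by simp))
  have h2 : (2 : ℕ∞ω) ≤ (∞ : ℕ∞ω) := WithTop.coe_le_coe.2 le_top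
  rw [heq.fderiv.fderiv_eq, fderiv_fderiv_comp_of_fderiv_eq_zero (u := f ∘ c.symm) (φ := c ∘ ψ)
    (hu.of_le h2) (hφ.of_le h2) hu0, hφd, hessian_apply]
  rfl

end Smooth

variable {V : Submodule ℝ C^∞⟮𝓡 m, M; ℝ⟯} {h : InnerProductSpace.Core ℝ V}
  [FiniteDimensional ℝ V]

/-- The gradient of `v`, in the coordinates of the preferred chart at `x`, at the point with
coordinates `y`. -/
def coordGradient (V : Submodule ℝ C^∞⟮𝓡 m, M; ℝ⟯) (h : InnerProductSpace.Core ℝ V)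
    [FiniteDimensional ℝ V] (x : M) (y : EuclideanSpace ℝ (Fin m)) :
    SampleSpace V h →L[ℝ] EuclideanSpace ℝ (Fin m) :=
  LinearMap.toContinuousLinearMap
    { toFun := fun v => ofDual (EuclideanSpace ℝ (Fin m))
        ((adjunction ((chartAt (EuclideanSpace ℝ (Fin m)) x).symm y) v).comp
          (mfderiv (𝓡 m) (𝓡 m) (chartAt (EuclideanSpace ℝ (Fin m)) x).symm y))
      map_add' := fun u v => by
        refine ext_inner_right ℝ fun X => ?_
        rw [map_add, inner_add_left, inner_ofDual, inner_ofDual, inner_ofDual]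
        rfl
      map_smul' := fun c v => by
        refine ext_inner_right ℝ fun X => ?_
        rw [map_smul, RingHom.id_apply, real_inner_smul_left, inner_ofDual, inner_ofDual]
        rfl }

theorem inner_coordGradient (x : M) (y X : EuclideanSpace ℝ (Fin m)) (v : SampleSpace V h) :
    ⟪coordGradient V h x y v, X⟫_ℝ =
      adjunction ((chartAt (EuclideanSpace ℝ (Fin m)) x).symm y) v
        (mfderiv (𝓡 m) (𝓡 m) (chartAt (EuclideanSpace ℝ (Fin m)) x).symm y X) :=
  inner_ofDual _ _

variable [IsManifold (𝓡 m) ∞ M]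

theorem coordGradient_eq (x : M) {y : EuclideanSpace ℝ (Fin m)}
    (hy : y ∈ (chartAt (EuclideanSpace ℝ (Fin m)) x).target) (v : SampleSpace V h) :
    coordGradient V h x y v = ofDual (EuclideanSpace ℝ (Fin m))
      (fderiv ℝ ((v : M → ℝ) ∘ (chartAt (EuclideanSpace ℝ (Fin m)) x).symm) y) := by
  rw [fderiv_comp_eq_mvfderiv_comp v.toSmooth.contMDiff (contMDiffAt_chart_symm hy)]
  rfl

theorem coordGradient_eq_zero_iff (x : M) {y : EuclideanSpace ℝ (Fin m)}
    (hy : y ∈ (chartAt (EuclideanSpace ℝ (Fin m)) x).target) (v : SampleSpace V h) :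
    coordGradient V h x y v = 0 ↔
      adjunction ((chartAt (EuclideanSpace ℝ (Fin m)) x).symm y) v = 0 := by
  constructor
  · intro h0
    ext X
    obtain ⟨Y, rfl⟩ := (coordFrame x hy).surjective X
    have := inner_coordGradient x y Y v
    rw [h0, inner_zero_left] at this
    exact this.symm
  · intro h0
    refine ext_inner_right ℝ fun X => ?_
    rw [inner_coordGradient, h0]
    simp

theorem ker_coordGradient (x : M) {y : EuclideanSpace ℝ (Fin m)}
    (hy : y ∈ (chartAt (EuclideanSpace ℝ (Fin m)) x).target) :
    LinearMap.ker (coordGradient V h x y : SampleSpace V h →ₗ[ℝ] EuclideanSpace ℝ (Fin m)) =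
      kernelSpace V h ((chartAt (EuclideanSpace ℝ (Fin m)) x).symm y) := by
  ext v
  exact coordGradient_eq_zero_iff x hy v

theorem coordGradient_surjective (hV : IsAmple V h) (x : M) {y : EuclideanSpace ℝ (Fin m)}
    (hy : y ∈ (chartAt (EuclideanSpace ℝ (Fin m)) x).target) :
    Function.Surjective (coordGradient V h x y) := by
  intro X
  -- The covector `⟪X, D⁻¹ ·⟫`, with `D` the coordinate frame, pulls back to `⟪X, ·⟫` in
  -- coordinates.
  obtain ⟨v, hv⟩ := hV ((chartAt (EuclideanSpace ℝ (Fin m)) x).symm y)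
    ((innerSL ℝ X).comp ((coordFrame x hy).symm : _ →L[ℝ] EuclideanSpace ℝ (Fin m)))
  refine ⟨v, ext_inner_right ℝ fun Y => ?_⟩
  rw [inner_coordGradient, hv, ← coe_coordFrame x hy]
  exact congrArg (fun Z => ⟪X, Z⟫_ℝ) ((coordFrame x hy).symm_apply_apply Y)

theorem contDiffOn_coordGradient (x : M) :
    ContDiffOn ℝ ∞ (coordGradient V h x) (chartAt (EuclideanSpace ℝ (Fin m)) x).target := by
  rw [contDiffOn_clm_apply]
  intro v y hy
  have ho := (chartAt (EuclideanSpace ℝ (Fin m)) x).open_target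
  have h1 := contDiffAt_comp_of_contMDiffAt v.toSmooth.contMDiff (contMDiffAt_chart_symm hy)
  have h2 : ContDiffAt ℝ ∞
      (fderiv ℝ ((v : M → ℝ) ∘ (chartAt (EuclideanSpace ℝ (Fin m)) x).symm)) y :=
    h1.fderiv_right (m := ∞) (by simp)
  have h3 := (ofDual (EuclideanSpace ℝ (Fin m))).contDiff.contDiffAt.comp y h2
  refine (h3.congr_of_eventuallyEq ?_).contDiffWithinAt
  filter_upwards [ho.mem_nhds hy] with z hz using coordGradient_eq x hz v

/-- For fixed `v` the coordinate gradient is `ofDual` of the differential of `v` in the chart, and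
the fixed linear map `ofDual` commutes with differentiation. -/
theorem inner_fderiv_coordGradient (x : M) {y : EuclideanSpace ℝ (Fin m)}
    (hy : y ∈ (chartAt (EuclideanSpace ℝ (Fin m)) x).target) (v : SampleSpace V h)
    (X Y : EuclideanSpace ℝ (Fin m)) :
    ⟪(fderiv ℝ (coordGradient V h x) y).flip v X, Y⟫_ℝ =
      fderiv ℝ (fderiv ℝ ((v : M → ℝ) ∘ (chartAt (EuclideanSpace ℝ (Fin m)) x).symm)) y X Y := by
  have ho := (chartAt (EuclideanSpace ℝ (Fin m)) x).open_target
  have h1 := contDiffAt_comp_of_contMDiffAt v.toSmooth.contMDiff (contMDiffAt_chart_symm hy)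
  have h2 : DifferentiableAt ℝ
      (fderiv ℝ ((v : M → ℝ) ∘ (chartAt (EuclideanSpace ℝ (Fin m)) x).symm)) y :=
    (h1.fderiv_right (m := ∞) (by simp)).differentiableAt (by simp)
  have h3 : HasFDerivAt (fun z => coordGradient V h x z v)
      ((ofDual (EuclideanSpace ℝ (Fin m))).comp
        (fderiv ℝ (fderiv ℝ ((v : M → ℝ) ∘ (chartAt (EuclideanSpace ℝ (Fin m)) x).symm)) y))
      y := by
    refine ((ofDual (EuclideanSpace ℝ (Fin m))).hasFDerivAt.comp y
      h2.hasFDerivAt).congr_of_eventuallyEq ?_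
    filter_upwards [ho.mem_nhds hy] with z hz using coordGradient_eq x hz v
  have h4 : HasFDerivAt (fun z => coordGradient V h x z v)
      ((fderiv ℝ (coordGradient V h x) y).flip v) y := by
    have h5 : DifferentiableAt ℝ (coordGradient V h x) y :=
      ((contDiffOn_coordGradient x).contDiffAt (ho.mem_nhds hy)).differentiableAt (by simp)
    simpa using h5.hasFDerivAt.clm_apply (hasFDerivAt_const v y)
  rw [h4.unique h3]
  exact inner_ofDual _ _

end Manifold

/-! ### The Riemannian density in coordinates -/

section Jacobian

variable {E E' F : Type*} [NormedAddCommGroup E] [InnerProductSpace ℝ E] [FiniteDimensional ℝ E]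
  [NormedAddCommGroup E'] [InnerProductSpace ℝ E'] [FiniteDimensional ℝ E']
  [NormedAddCommGroup F] [InnerProductSpace ℝ F]

theorem jacobian_nonneg (B : E →ₗ[ℝ] F) : 0 ≤ jacobian B := Real.sqrt_nonneg _

variable [FiniteDimensional ℝ F]

theorem det_adjoint_comp_self_nonneg (B : E →ₗ[ℝ] F) :
    0 ≤ LinearMap.det (LinearMap.adjoint B ∘ₗ B) := by
  have : (Matrix.gram ℝ fun i => B (stdOrthonormalBasis ℝ E i)).det =
      LinearMap.det (LinearMap.adjoint B ∘ₗ B) := by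
    rw [← LinearMap.det_toMatrix (stdOrthonormalBasis ℝ E).toBasis]
    congr 1
    ext i j
    simp [LinearMap.toMatrix_apply, OrthonormalBasis.repr_apply_apply,
      LinearMap.adjoint_inner_right]
  rw [← this]
  exact (Matrix.posSemidef_gram ℝ _).det_nonneg

theorem sq_jacobian (B : E →ₗ[ℝ] F) :
    jacobian B ^ 2 = LinearMap.det (LinearMap.adjoint B ∘ₗ B) := by
  rw [jacobian_eq_sqrt_det_adjoint_comp, Real.sq_sqrt (det_adjoint_comp_self_nonneg B)]

/-- `D† T D = (D† D)(D⁻¹ T D)`. This is how the determinant of an operator representing a form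
changes when the frame is not orthonormal. -/
theorem det_adjoint_comp_comp (D : E ≃ₗ[ℝ] E') (T : E' →ₗ[ℝ] E') :
    LinearMap.det (LinearMap.adjoint (D : E →ₗ[ℝ] E') ∘ₗ T ∘ₗ (D : E →ₗ[ℝ] E')) =
      jacobian (D : E →ₗ[ℝ] E') ^ 2 * LinearMap.det T := by
  have h1 : LinearMap.adjoint (D : E →ₗ[ℝ] E') ∘ₗ T ∘ₗ (D : E →ₗ[ℝ] E') =
      (LinearMap.adjoint (D : E →ₗ[ℝ] E') ∘ₗ (D : E →ₗ[ℝ] E')) ∘ₗ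
        ((D.symm : E' →ₗ[ℝ] E) ∘ₗ T ∘ₗ (D.symm.symm : E →ₗ[ℝ] E')) := by
    ext v
    simp
  rw [h1, LinearMap.det_comp, LinearMap.det_conj, sq_jacobian]

theorem jacobian_comp (D : E ≃ₗ[ℝ] E') (B : E' →ₗ[ℝ] F) :
    jacobian (B ∘ₗ (D : E →ₗ[ℝ] E')) = jacobian (D : E →ₗ[ℝ] E') * jacobian B := by
  refine (sq_eq_sq₀ (jacobian_nonneg _)
    (mul_nonneg (jacobian_nonneg _) (jacobian_nonneg _))).1 ?_
  rw [sq_jacobian, mul_pow, sq_jacobian B, ← det_adjoint_comp_comp, LinearMap.adjoint_comp]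
  rfl

theorem jacobian_pos (D : E ≃ₗ[ℝ] E') : 0 < jacobian (D : E →ₗ[ℝ] E') := by
  have h1 := jacobian_comp D (D.symm : E' →ₗ[ℝ] E)
  have h2 : (D.symm : E' →ₗ[ℝ] E) ∘ₗ (D : E →ₗ[ℝ] E') = LinearMap.id := by
    ext v
    simp
  have h3 : jacobian (LinearMap.id : E →ₗ[ℝ] E) = 1 := by
    have := sq_jacobian (LinearMap.id : E →ₗ[ℝ] E)
    rw [LinearMap.comp_id, det_adjoint, LinearMap.det_id] at this
    exact (pow_eq_one_iff_of_nonneg (jacobian_nonneg _) two_ne_zero).1 this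
  rw [h2, h3] at h1
  refine lt_of_le_of_ne (jacobian_nonneg _) fun h0 => ?_
  rw [← h0, zero_mul] at h1
  exact one_ne_zero h1

theorem jacobian_comp_endomorphism (T : E →ₗ[ℝ] E) (B : E →ₗ[ℝ] F) :
    jacobian (B ∘ₗ T) = |LinearMap.det T| * jacobian B := by
  refine (sq_eq_sq₀ (jacobian_nonneg _)
    (mul_nonneg (abs_nonneg _) (jacobian_nonneg _))).1 ?_
  have : LinearMap.adjoint (B ∘ₗ T) ∘ₗ B ∘ₗ T =
      LinearMap.adjoint T ∘ₗ (LinearMap.adjoint B ∘ₗ B) ∘ₗ T := by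
    rw [LinearMap.adjoint_comp]
    rfl
  rw [sq_jacobian, this, LinearMap.det_comp, LinearMap.det_comp, det_adjoint, mul_pow, sq_abs,
    sq_jacobian]
  ring

end Jacobian

/-! ### Powers of the volume density in the gradient and in its derivative -/

section Density

variable {m : ℕ} {M : Type*} [TopologicalSpace M] [ChartedSpace (EuclideanSpace ℝ (Fin m)) M]
  [IsManifold (𝓡 m) ∞ M] [RiemannianBundle (fun x : M => TangentSpace (𝓡 m) x)]

theorem volumeDensity_eq_jacobian (x : M) {y : EuclideanSpace ℝ (Fin m)}
    (hy : y ∈ (chartAt (EuclideanSpace ℝ (Fin m)) x).target) :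
    volumeDensity x y =
      jacobian (coordFrame x hy).toLinearEquiv.toLinearMap := by
  rw [jacobian_eq (EuclideanSpace.basisFun (Fin m) ℝ), volumeDensity]
  congr 2
  ext i j
  simp only [Matrix.gram, Matrix.of_apply, EuclideanSpace.basisFun_apply]
  rfl

theorem volumeDensity_pos (x : M) {y : EuclideanSpace ℝ (Fin m)}
    (hy : y ∈ (chartAt (EuclideanSpace ℝ (Fin m)) x).target) : 0 < volumeDensity x y := by
  rw [volumeDensity_eq_jacobian x hy]
  exact jacobian_pos _

variable {V : Submodule ℝ C^∞⟮𝓡 m, M; ℝ⟯} {h : InnerProductSpace.Core ℝ V}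
  [FiniteDimensional ℝ V]

/-- `A_y† = 𝒜† ∘ D` for the coordinate frame `D`, whose Jacobian is the volume density. -/
theorem jacobian_adjoint_coordGradient (x : M) {y : EuclideanSpace ℝ (Fin m)}
    (hy : y ∈ (chartAt (EuclideanSpace ℝ (Fin m)) x).target) :
    jacobian (LinearMap.adjoint (coordGradient V h x y :
        SampleSpace V h →ₗ[ℝ] EuclideanSpace ℝ (Fin m))) =
      volumeDensity x y * jacobian (dualAdjunction (V := V) (h := h)
        ((chartAt (EuclideanSpace ℝ (Fin m)) x).symm y)) := by
  rw [volumeDensity_eq_jacobian x hy, ← jacobian_comp]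
  congr 1
  ext X : 1
  refine ext_inner_right ℝ fun v => ?_
  rw [LinearMap.adjoint_inner_left, real_inner_comm]
  exact (inner_coordGradient x y X v).trans (inner_dualAdjunction _ _ v).symm

/-- On `K_x` the derivative of the coordinate gradient is `D† Hess D`. The two frames give the
square of the volume density. -/
theorem abs_det_fderiv_coordGradient (x : M) {y : EuclideanSpace ℝ (Fin m)}
    (hy : y ∈ (chartAt (EuclideanSpace ℝ (Fin m)) x).target) {v : SampleSpace V h}
    (hv : v ∈ kernelSpace V h ((chartAt (EuclideanSpace ℝ (Fin m)) x).symm y)) :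
    |((fderiv ℝ (coordGradient V h x) y).flip v).det| = volumeDensity x y ^ 2 *
      |(hessianOperator (m := m) v.toSmooth
        ((chartAt (EuclideanSpace ℝ (Fin m)) x).symm y)).det| := by
  set T := hessianOperator (m := m) v.toSmooth
        ((chartAt (EuclideanSpace ℝ (Fin m)) x).symm y) with hT
  have h1 : (((fderiv ℝ (coordGradient V h x) y).flip v :
      EuclideanSpace ℝ (Fin m) →L[ℝ] EuclideanSpace ℝ (Fin m)) :
        EuclideanSpace ℝ (Fin m) →ₗ[ℝ] EuclideanSpace ℝ (Fin m)) =
      LinearMap.adjoint (coordFrame x hy).toLinearEquiv.toLinearMap ∘ₗ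
        T.toLinearMap ∘ₗ
          (coordFrame x hy).toLinearEquiv.toLinearMap := by
    ext X : 1
    refine ext_inner_right ℝ fun Y => ?_
    rw [LinearMap.comp_apply, LinearMap.adjoint_inner_left]
    refine (inner_fderiv_coordGradient x hy v X Y).trans ?_
    rw [fderiv_fderiv_comp_eq_hessian v.toSmooth.contMDiff (contMDiffAt_chart_symm hy)
      (LinearMap.mem_ker.1 hv)]
    exact (inner_operatorOfBilin _ _ _).symm
  rw [ContinuousLinearMap.det, h1, det_adjoint_comp_comp, volumeDensity_eq_jacobian x hy, abs_mul,
    abs_of_nonneg (sq_nonneg _)]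

end Density

/-! ### The density of critical points in coordinates -/

section CriticalDensity

theorem lintegral_submodule_congr {F : Type*} [NormedAddCommGroup F] [InnerProductSpace ℝ F]
    [FiniteDimensional ℝ F] [MeasurableSpace F] [BorelSpace F] {K K' : Submodule ℝ F}
    (hK : K = K') (g : F → ℝ≥0∞) : ∫⁻ v : K, g v = ∫⁻ v : K', g v := by
  subst hK
  rfl

variable {m : ℕ} {M : Type*} [TopologicalSpace M] [ChartedSpace (EuclideanSpace ℝ (Fin m)) M]
  {V : Submodule ℝ C^∞⟮𝓡 m, M; ℝ⟯} {h : InnerProductSpace.Core ℝ V} [FiniteDimensional ℝ V]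

theorem finrank_kernelSpace_add (hV : IsAmple V h) (x : M) :
    Module.finrank ℝ (kernelSpace V h x) + m = Module.finrank ℝ (SampleSpace V h) := by
  have h1 := LinearMap.finrank_range_add_finrank_ker (adjunction (V := V) (h := h) x)
  rw [LinearMap.range_eq_top.2 (hV x), finrank_top] at h1
  have h2 : Module.finrank ℝ (TangentSpace (𝓡 m) x →L[ℝ] ℝ) = m := by
    have e1 : (TangentSpace (𝓡 m) x →L[ℝ] ℝ) ≃ₗ[ℝ] Module.Dual ℝ (EuclideanSpace ℝ (Fin m)) :=
      (LinearMap.toContinuousLinearMap (𝕜 := ℝ) (E := EuclideanSpace ℝ (Fin m)) (F' := ℝ)).symm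
    rw [e1.finrank_eq, Subspace.dual_finrank_eq, finrank_euclideanSpace_fin]
  rw [h2] at h1
  rw [← h1, add_comm]
  rfl

variable [RiemannianBundle (fun x : M => TangentSpace (𝓡 m) x)]

theorem hessianAverage_nonneg (x : M) : 0 ≤ hessianAverage V h x :=
  integral_nonneg fun _ => abs_nonneg _

theorem criticalDensity_nonneg (x : M) : 0 ≤ criticalDensity V h x :=
  div_nonneg (hessianAverage_nonneg x) (jacobian_nonneg _)

variable [IsManifold (𝓡 m) ∞ M]

/-- The coordinate fields are images of constant fields under the tangent map of the inverse chart,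
hence continuous sections of the tangent bundle, and the metric pairs them continuously. -/
theorem continuousOn_volumeDensity
    [IsContMDiffRiemannianBundle (𝓡 m) ∞ (EuclideanSpace ℝ (Fin m))
      (fun x : M => TangentSpace (𝓡 m) x)] (x : M) :
    ContinuousOn (volumeDensity x) (chartAt (EuclideanSpace ℝ (Fin m)) x).target := by
  have : IsManifold (𝓡 m) 1 M := IsManifold.of_le (n := ∞) (by simp)
  have : IsContinuousRiemannianBundle (EuclideanSpace ℝ (Fin m))
      (fun x : M => TangentSpace (𝓡 m) x) := by
    obtain ⟨g, hg, hg'⟩ := IsContMDiffRiemannianBundle.exists_contMDiff (IB := 𝓡 m) (n := ∞)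
      (F := EuclideanSpace ℝ (Fin m)) (E := fun x : M => TangentSpace (𝓡 m) x)
    exact ⟨g, hg.continuous, hg'⟩
  set c := chartAt (EuclideanSpace ℝ (Fin m)) x with hc
  have hvec : ∀ i, ContinuousOn (fun y => (⟨c.symm y, coordVector x y i⟩ :
      TotalSpace (EuclideanSpace ℝ (Fin m)) (fun x : M => TangentSpace (𝓡 m) x))) c.target := by
    intro i
    have hu : UniqueMDiffOn (𝓡 m) c.target := c.open_target.uniqueMDiffOn
    have h1 : ContinuousOn (tangentMapWithin (𝓡 m) (𝓡 m) c.symm c.target) _ :=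
      (contMDiffOn_chart_symm (I := 𝓡 m) (n := ∞) (x := x)).continuousOn_tangentMapWithin
        (by simp) hu
    have h2 : Continuous fun y : EuclideanSpace ℝ (Fin m) =>
        (⟨y, EuclideanSpace.single i (1 : ℝ)⟩ :
          TangentBundle (𝓡 m) (EuclideanSpace ℝ (Fin m))) := by
      have h3 := (tangentBundleModelSpaceHomeomorph (𝓡 m)).symm.continuous
      rw [tangentBundleModelSpaceHomeomorph_coe_symm] at h3
      exact h3.comp (Continuous.prodMk_left (EuclideanSpace.single i (1 : ℝ)))
    refine (h1.comp h2.continuousOn (fun y hy => hy)).congr fun y hy => ?_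
    simp only [Function.comp_apply, tangentMapWithin, coordVector]
    rw [mfderivWithin_of_isOpen c.open_target hy]
  refine Real.continuous_sqrt.comp_continuousOn ?_
  have hmat : ContinuousOn (fun y => Matrix.gram ℝ (coordVector x y)) c.target := by
    refine continuousOn_pi.2 fun i => continuousOn_pi.2 fun j => ?_
    exact (hvec i).inner_bundle (hvec j)
  exact (continuous_id.matrix_det).comp_continuousOn hmat

theorem ofReal_sq_volumeDensity_mul_hessianAverage (x : M) {y : EuclideanSpace ℝ (Fin m)}
    (hy : y ∈ (chartAt (EuclideanSpace ℝ (Fin m)) x).target) :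
    ENNReal.ofReal (volumeDensity x y ^ 2 *
        hessianAverage V h ((chartAt (EuclideanSpace ℝ (Fin m)) x).symm y)) =
      ∫⁻ v : sphere (0 : kernelSpace V h ((chartAt (EuclideanSpace ℝ (Fin m)) x).symm y)) 1,
        ENNReal.ofReal |((fderiv ℝ (coordGradient V h x) y).flip (v.1.1 : SampleSpace V h)).det|
          ∂(sphereArea (kernelSpace V h ((chartAt (EuclideanSpace ℝ (Fin m)) x).symm y))) := by
  set K := kernelSpace V h ((chartAt (EuclideanSpace ℝ (Fin m)) x).symm y) with hK
  have h1 : volumeDensity x y ^ 2 *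
        hessianAverage V h ((chartAt (EuclideanSpace ℝ (Fin m)) x).symm y) =
      ∫ v : sphere (0 : K) 1,
        |((fderiv ℝ (coordGradient V h x) y).flip (v.1.1 : SampleSpace V h)).det|
          ∂(sphereArea K) := by
    rw [hessianAverage, ← integral_const_mul]
    refine integral_congr_ae (Filter.Eventually.of_forall fun v => ?_)
    exact (abs_det_fderiv_coordGradient x hy v.1.2).symm
  have hcont : Continuous fun v : sphere (0 : K) 1 =>
      |((fderiv ℝ (coordGradient V h x) y).flip (v.1.1 : SampleSpace V h)).det| :=
    (ContinuousLinearMap.continuous_det.comp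
      ((fderiv ℝ (coordGradient V h x) y).flip.continuous.comp
        (continuous_subtype_val.comp continuous_subtype_val))).abs
  have hfin : IsFiniteMeasure (sphereArea K) :=
    inferInstanceAs (IsFiniteMeasure (volume : Measure K).toSphere)
  have hcomp : CompactSpace (sphere (0 : K) 1) := by
    have : ProperSpace K := FiniteDimensional.proper ℝ K
    exact isCompact_iff_compactSpace.1 (isCompact_sphere (0 : K) 1)
  -- The integrand is continuous on a compact sphere, hence integrable, so the Bochner integral is
  -- not the default value `0`.
  rw [h1, ofReal_integral_eq_lintegral_ofReal]
  · have h2 := hcont.continuousOn.integrableOn_compact (μ := sphereArea K) isCompact_univ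
    rwa [integrableOn_univ] at h2
  · exact Filter.Eventually.of_forall fun v => abs_nonneg _

/-- In coordinates, the expected number of critical points has the density `Δ / J`. -/
theorem finrank_mul_zeroDensity (hV : IsAmple V h) (x : M) {y : EuclideanSpace ℝ (Fin m)}
    (hy : y ∈ (chartAt (EuclideanSpace ℝ (Fin m)) x).target) :
    (Module.finrank ℝ (SampleSpace V h) : ℝ≥0∞) * zeroDensity (coordGradient V h x) y =
      ENNReal.ofReal (criticalDensity V h ((chartAt (EuclideanSpace ℝ (Fin m)) x).symm y)) *
        ENNReal.ofReal (volumeDensity x y) := by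
  set z := (chartAt (EuclideanSpace ℝ (Fin m)) x).symm y with hz
  have hvd := volumeDensity_pos x hy
  set φ : SampleSpace V h → ℝ≥0∞ := fun v =>
    ENNReal.ofReal |((fderiv ℝ (coordGradient V h x) y).flip v).det| with hφ
  have hφm : Measurable φ := ((ContinuousLinearMap.continuous_det.comp
    (fderiv ℝ (coordGradient V h x) y).flip.continuous).abs.measurable).ennreal_ofReal
  have hhom : ∀ r : ℝ, 0 < r → ∀ v, φ (r • v) = ENNReal.ofReal (r ^ m) * φ v := by
    intro r hr v
    simp only [hφ]
    rw [← ENNReal.ofReal_mul (by positivity), map_smul, ContinuousLinearMap.det,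
      ContinuousLinearMap.toLinearMap_smul, LinearMap.det_smul, finrank_euclideanSpace_fin, abs_mul,
      abs_of_pos (pow_pos hr m)]
  -- `φ` has degree `m` and `dim K_z = N - m`, so the ball-to-sphere factor is `(N - m) + m = N`.
  have hpolar : (Module.finrank ℝ (SampleSpace V h) : ℝ≥0∞) *
      ∫⁻ v : kernelSpace V h z, φ v * (ball (0 : SampleSpace V h) 1).indicator (fun _ => 1)
        (v : SampleSpace V h) =
      ENNReal.ofReal (volumeDensity x y ^ 2 * hessianAverage V h z) := by
    rw [ofReal_sq_volumeDensity_mul_hessianAverage x hy]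
    -- Polar coordinates need `K_z ≠ 0`. If `K_z = 0` then `N = m` and the sphere is empty; the left
    -- side vanishes because `N = 0`, or because the zero operator has determinant `0` when `m > 0`.
    rcases subsingleton_or_nontrivial (kernelSpace V h z) with hK | hK
    · have hempty : IsEmpty (sphere (0 : kernelSpace V h z) 1) := by
        refine ⟨fun s => ?_⟩
        have := norm_eq_of_mem_sphere s
        rw [Subsingleton.elim (s : kernelSpace V h z) 0, norm_zero] at this
        exact zero_ne_one this
      refine Eq.trans ?_ (lintegral_of_isEmpty _ _).symm
      have hfr := finrank_kernelSpace_add hV z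
      rw [Module.finrank_zero_of_subsingleton, zero_add] at hfr
      rcases Nat.eq_zero_or_pos m with h0 | h0
      · have hm : (m : ℝ≥0∞) = 0 := Nat.cast_eq_zero.2 h0
        rw [← hfr, hm, zero_mul]
      · have hφ0 : ∀ v : kernelSpace V h z, φ v = 0 := by
          intro v
          rw [Subsingleton.elim v 0]
          simp only [hφ, ZeroMemClass.coe_zero, map_zero]
          have : (0 : EuclideanSpace ℝ (Fin m) →L[ℝ] EuclideanSpace ℝ (Fin m)).det = 0 := by
            rw [ContinuousLinearMap.det, ContinuousLinearMap.toLinearMap_zero,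
              LinearMap.det_zero, finrank_euclideanSpace_fin, zero_pow h0.ne']
          rw [this, abs_zero, ENNReal.ofReal_zero]
        simp [hφ0]
    · have h3 := lintegral_sphere_of_homogeneous (E := kernelSpace V h z) m
        (φ := fun v => φ (v : SampleSpace V h)) (fun r hr v => hhom r hr v)
        (hφm.comp (measurable_subtype_coe.comp measurable_subtype_coe)).aemeasurable
      rw [finrank_kernelSpace_add hV z] at h3
      refine Eq.trans ?_ h3.symm
      congr 1
      rw [← lintegral_indicator measurableSet_ball]
      refine lintegral_congr fun v => ?_
      by_cases hv : v ∈ ball (0 : kernelSpace V h z) 1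
      · have hv' : (v : SampleSpace V h) ∈ ball (0 : SampleSpace V h) 1 := by
          simpa using hv
        rw [Set.indicator_of_mem hv, Set.indicator_of_mem hv', mul_one]
      · have hv' : (v : SampleSpace V h) ∉ ball (0 : SampleSpace V h) 1 := by
          simpa using hv
        rw [Set.indicator_of_notMem hv, Set.indicator_of_notMem hv', mul_zero]
  rw [zeroDensity, jacobian_adjoint_coordGradient x hy,
    lintegral_submodule_congr (ker_coordGradient x hy) (fun v => φ v *
      (ball (0 : SampleSpace V h) 1).indicator (fun _ => 1) v), mul_left_comm, hpolar,
    ← ENNReal.ofReal_mul (inv_nonneg.2 (mul_nonneg hvd.le (jacobian_nonneg _))),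
    ← ENNReal.ofReal_mul (criticalDensity_nonneg z), criticalDensity]
  congr 1
  rw [mul_inv, ← hz]
  field_simp

end CriticalDensity

/-! ### The Riemannian volume in a chart -/

theorem exists_finite_measurable_partition {M : Type*} [TopologicalSpace M] [CompactSpace M]
    [MeasurableSpace M] [BorelSpace M] {O : M → Set M} (hO : ∀ x, IsOpen (O x))
    (hx : ∀ x, x ∈ O x) :
    ∃ (n : ℕ) (p : Fin n → M) (P : Fin n → Set M), (∀ i, MeasurableSet (P i)) ∧
      Pairwise (Function.onFun Disjoint P) ∧ (⋃ i, P i) = Set.univ ∧ ∀ i, P i ⊆ O (p i) := by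
  obtain ⟨t, ht⟩ := isCompact_univ.elim_nhds_subcover O fun x _ => (hO x).mem_nhds (hx x)
  let p : Fin t.card → M := fun i => t.equivFin.symm i
  refine ⟨t.card, p, disjointed fun i => O (p i), fun i => ?_, disjoint_disjointed _, ?_,
    fun i => disjointed_subset _ i⟩
  · rw [disjointed_apply, Finset.sup_set_eq_biUnion]
    exact (hO (p i)).measurableSet.diff
      (Finset.measurableSet_biUnion _ fun j _ => (hO (p j)).measurableSet)
  · rw [iUnion_disjointed, Set.eq_univ_iff_forall]
    intro x
    obtain ⟨z, hz, hxz⟩ := Set.mem_iUnion₂.1 (ht.2 (Set.mem_univ x))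
    refine Set.mem_iUnion.2 ⟨t.equivFin ⟨z, hz⟩, ?_⟩
    simpa [p] using hxz

/-- All tangent spaces are the same model space, but their inner products depend on the base point.
This moves vectors between base points that are equal but not definitionally so. -/
theorem inner_tangentSpace_congr {m : ℕ} {M : Type*} [TopologicalSpace M]
    [ChartedSpace (EuclideanSpace ℝ (Fin m)) M]
    [RiemannianBundle (fun x : M => TangentSpace (𝓡 m) x)] {p q : M} (hpq : p = q) (X Y : EuclideanSpace ℝ (Fin m)) :
    @inner ℝ (TangentSpace (𝓡 m) p) _ X Y = @inner ℝ (TangentSpace (𝓡 m) q) _ X Y := by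
  subst hpq
  rfl

section Volume

variable {m : ℕ} {M : Type*} [TopologicalSpace M] [ChartedSpace (EuclideanSpace ℝ (Fin m)) M]
  [MeasurableSpace M] [BorelSpace M]

/-- The part of the domain of the chart at `x` that corresponds to the set `P`. -/
def chartPart (x : M) (P : Set M) : Set (EuclideanSpace ℝ (Fin m)) :=
  (chartAt (EuclideanSpace ℝ (Fin m)) x).symm ⁻¹' P ∩
    (chartAt (EuclideanSpace ℝ (Fin m)) x).target

theorem aemeasurable_chart_symm (x : M) :
    AEMeasurable (chartAt (EuclideanSpace ℝ (Fin m)) x).symm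
      ((volume : Measure (EuclideanSpace ℝ (Fin m))).restrict
        (chartAt (EuclideanSpace ℝ (Fin m)) x).target) :=
  (chartAt (EuclideanSpace ℝ (Fin m)) x).continuousOn_symm.aemeasurable
    (chartAt (EuclideanSpace ℝ (Fin m)) x).open_target.measurableSet

theorem measurableSet_chartPart (x : M) {P : Set M} (hP : MeasurableSet P) :
    MeasurableSet (chartPart (m := m) x P) := by
  set c := chartAt (EuclideanSpace ℝ (Fin m)) x with hc
  have h1 : Measurable (c.target.domRestrict c.symm) := c.continuousOn_symm.domRestrict.measurable
  have h2 := (c.open_target.measurableSet).subtype_image (h1 hP)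
  convert h2 using 1
  ext y
  simp only [chartPart, Set.mem_inter_iff, Set.mem_preimage, Set.mem_image, Subtype.exists,
    Set.domRestrict_apply]
  constructor
  · rintro ⟨h3, h4⟩
    exact ⟨y, h4, h3, rfl⟩
  · rintro ⟨y', h4, h3, rfl⟩
    exact ⟨h3, h4⟩

variable [RiemannianBundle (fun x : M => TangentSpace (𝓡 m) x)]

theorem chartVolume_apply (x : M) {P : Set M} (hP : MeasurableSet P) :
    chartVolume (m := m) x P = ∫⁻ y in chartPart (m := m) x P, ENNReal.ofReal (volumeDensity x y) := by
  rw [chartVolume, Measure.map_apply_of_aemeasurable _ hP, withDensity_apply',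
    Measure.restrict_restrict' (chartAt (EuclideanSpace ℝ (Fin m)) x).open_target.measurableSet]
  · rfl
  · exact (aemeasurable_chart_symm x).mono_ac (withDensity_absolutelyContinuous _ _)

theorem chartVolume_restrict (x : M) {P : Set M} (hP : MeasurableSet P) :
    (chartVolume (m := m) x).restrict P =
      ((volume.restrict (chartPart x P)).withDensity
        fun y => ENNReal.ofReal (volumeDensity x y)).map
          (chartAt (EuclideanSpace ℝ (Fin m)) x).symm := by
  have hm : AEMeasurable (chartAt (EuclideanSpace ℝ (Fin m)) x).symm
      ((volume.restrict (chartPart x P)).withDensity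
        fun y => ENNReal.ofReal (volumeDensity x y)) :=
    ((aemeasurable_chart_symm x).mono_measure
      (Measure.restrict_mono Set.inter_subset_right le_rfl)).mono_ac
        (withDensity_absolutelyContinuous _ _)
  ext B hB
  rw [Measure.restrict_apply hB, chartVolume_apply x (hB.inter hP),
    Measure.map_apply_of_aemeasurable hm hB, withDensity_apply',
    Measure.restrict_restrict' (measurableSet_chartPart x hP)]
  congr 2
  ext y
  simp only [chartPart, Set.mem_inter_iff, Set.mem_preimage]
  tauto

variable [IsManifold (𝓡 m) ∞ M]

/-- The coordinate frames differ by the differential of the transition map `τ`, so the densities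
differ by `|det dτ|`, which is the factor in the change of variables. -/
theorem chartVolume_eq_on_overlap (x x' : M) {P : Set M} (hP : MeasurableSet P)
    (hx : P ⊆ (chartAt (EuclideanSpace ℝ (Fin m)) x).source)
    (hx' : P ⊆ (chartAt (EuclideanSpace ℝ (Fin m)) x').source) :
    chartVolume (m := m) x P = chartVolume (m := m) x' P := by
  rw [chartVolume_apply x hP, chartVolume_apply x' hP]
  set c := chartAt (EuclideanSpace ℝ (Fin m)) x with hc
  set c' := chartAt (EuclideanSpace ℝ (Fin m)) x' with hc'
  set τ : EuclideanSpace ℝ (Fin m) → EuclideanSpace ℝ (Fin m) := c' ∘ c.symm with hτ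
  have hτm : ∀ y ∈ chartPart x P, ContMDiffAt (𝓡 m) (𝓡 m) ∞ τ y := fun y hy =>
    (contMDiffAt_chart (hx' hy.1)).comp y (contMDiffAt_chart_symm hy.2)
  have hτd : ∀ y ∈ chartPart x P, HasFDerivWithinAt τ (fderiv ℝ τ y) (chartPart x P) y :=
    fun y hy => ((hτm y hy).contDiffAt.differentiableAt (by simp)).hasFDerivAt.hasFDerivWithinAt
  have hinj : Set.InjOn τ (chartPart x P) := by
    intro y hy z hz hyz
    have h1 : c.symm y = c.symm z := c'.injOn (hx' hy.1) (hx' hz.1) hyz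
    exact c.symm.injOn hy.2 hz.2 h1
  have himage : τ '' chartPart x P = chartPart x' P := by
    ext y
    constructor
    · rintro ⟨z, hz, rfl⟩
      refine ⟨?_, c'.map_source (hx' hz.1)⟩
      change c'.symm (c' (c.symm z)) ∈ P
      rw [c'.left_inv (hx' hz.1)]
      exact hz.1
    · rintro ⟨hy, hyt⟩
      have hys : c'.symm y ∈ c.source := hx hy
      refine ⟨c (c'.symm y), ⟨?_, c.map_source hys⟩, ?_⟩
      · change c.symm (c (c'.symm y)) ∈ P
        rw [c.left_inv hys]
        exact hy
      · change c' (c.symm (c (c'.symm y))) = y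
        rw [c.left_inv hys, c'.right_inv hyt]
  rw [← himage, lintegral_image_eq_lintegral_abs_det_fderiv_mul volume
    (measurableSet_chartPart x hP) hτd hinj]
  refine setLIntegral_congr_fun (measurableSet_chartPart x hP) fun y hy => ?_
  have hty : τ y ∈ c'.target := c'.map_source (hx' hy.1)
  have hsymm : c'.symm (τ y) = c.symm y := c'.left_inv (hx' hy.1)
  have hev : c.symm =ᶠ[nhds y] c'.symm ∘ τ := by
    have h1 : ∀ᶠ z in nhds y, c.symm z ∈ c'.source :=
      (c.continuousAt_symm hy.2).eventually (c'.open_source.mem_nhds (hx' hy.1))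
    filter_upwards [h1] with z hz
    exact (c'.left_inv hz).symm
  have hder : mfderiv (𝓡 m) (𝓡 m) (c'.symm ∘ τ) y =
      (mfderiv (𝓡 m) (𝓡 m) c'.symm (τ y)).comp (mfderiv (𝓡 m) (𝓡 m) τ y) :=
    mfderiv_comp y ((contMDiffAt_chart_symm hty).mdifferentiableAt (by simp))
      ((hτm y hy).mdifferentiableAt (by simp))
  have hτf : mfderiv (𝓡 m) (𝓡 m) τ y = fderiv ℝ τ y := mfderiv_eq_fderiv
  have hkey : volumeDensity x y = |(fderiv ℝ τ y).det| * volumeDensity x' (τ y) := by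
    rw [volumeDensity_eq_jacobian x' hty, ContinuousLinearMap.det, ← jacobian_comp_endomorphism,
      jacobian_eq (EuclideanSpace.basisFun (Fin m) ℝ), volumeDensity]
    have hvec : ∀ X : EuclideanSpace ℝ (Fin m), (mfderiv (𝓡 m) (𝓡 m) c.symm y X :
        EuclideanSpace ℝ (Fin m)) = mfderiv (𝓡 m) (𝓡 m) c'.symm (τ y) (fderiv ℝ τ y X) := by
      intro X
      have h1 : (mfderiv (𝓡 m) (𝓡 m) c.symm y :
          EuclideanSpace ℝ (Fin m) →L[ℝ] EuclideanSpace ℝ (Fin m)) =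
          mfderiv (𝓡 m) (𝓡 m) (c'.symm ∘ τ) y := hev.mfderiv_eq
      refine (congrArg (fun L : EuclideanSpace ℝ (Fin m) →L[ℝ] EuclideanSpace ℝ (Fin m) => L X)
        (h1.trans hder)).trans ?_
      exact congrArg (fun L : EuclideanSpace ℝ (Fin m) →L[ℝ] EuclideanSpace ℝ (Fin m) =>
        mfderiv (𝓡 m) (𝓡 m) c'.symm (τ y) (L X)) hτf
    congr 2
    ext i j
    simp only [Matrix.gram, Matrix.of_apply, EuclideanSpace.basisFun_apply]
    refine (inner_tangentSpace_congr hsymm.symm _ _).trans ?_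
    have h2 := hvec (EuclideanSpace.single i 1)
    have h3 := hvec (EuclideanSpace.single j 1)
    exact congrArg₂ (fun X Y : EuclideanSpace ℝ (Fin m) =>
      @inner ℝ (TangentSpace (𝓡 m) (c'.symm (τ y))) _ X Y) h2 h3
  rw [hkey, ENNReal.ofReal_mul (abs_nonneg _)]

/-- One inequality is the definition of a supremum. For the other, cut `M` into finitely many pieces
lying in chart domains: the sum of the corresponding chart volumes dominates every `chartVolume z`
by agreement on overlaps, and on the domain of the chart at `x` it is bounded by `chartVolume x`. -/
theorem riemannianVolume_restrict_source [CompactSpace M] (x : M) :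
    (riemannianVolume m M).restrict (chartAt (EuclideanSpace ℝ (Fin m)) x).source =
      (chartVolume (m := m) x).restrict (chartAt (EuclideanSpace ℝ (Fin m)) x).source := by
  obtain ⟨n, p, P, hPm, hPd, hPu, hPs⟩ := exists_finite_measurable_partition
    (O := fun x : M => (chartAt (EuclideanSpace ℝ (Fin m)) x).source)
    (fun x => (chartAt (EuclideanSpace ℝ (Fin m)) x).open_source) (fun x => mem_chart_source _ x)
  have hsplit : ∀ (z : M) (B : Set M), MeasurableSet B →
      chartVolume (m := m) z B = ∑ i, chartVolume (m := m) z (B ∩ P i) := by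
    intro z B hB
    rw [← tsum_fintype (L := .unconditional _), ← measure_iUnion, ← Set.inter_iUnion, hPu,
      Set.inter_univ]
    · exact fun i j hij => (hPd hij).mono Set.inter_subset_right Set.inter_subset_right
    · exact fun i => hB.inter (hPm i)
  have hnull : ∀ (z : M) (B : Set M), MeasurableSet B → chartVolume (m := m) z B =
      chartVolume (m := m) z (B ∩ (chartAt (EuclideanSpace ℝ (Fin m)) z).source) := by
    intro z B hB
    have hs := (chartAt (EuclideanSpace ℝ (Fin m)) z).open_source.measurableSet
    rw [chartVolume_apply z hB, chartVolume_apply z (hB.inter hs)]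
    congr 2
    ext y
    simp only [chartPart, Set.mem_inter_iff, Set.mem_preimage]
    constructor
    · rintro ⟨h1, h2⟩
      exact ⟨⟨h1, (chartAt (EuclideanSpace ℝ (Fin m)) z).map_target h2⟩, h2⟩
    · rintro ⟨⟨h1, -⟩, h2⟩
      exact ⟨h1, h2⟩
  have hle : riemannianVolume m M ≤ ∑ i, (chartVolume (m := m) (p i)).restrict (P i) := by
    refine iSup_le fun z => Measure.le_iff.2 fun B hB => ?_
    rw [hsplit z B hB, Measure.finsetSum_apply]
    refine Finset.sum_le_sum fun i _ => ?_
    have hs := (chartAt (EuclideanSpace ℝ (Fin m)) z).open_source.measurableSet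
    rw [hnull z _ (hB.inter (hPm i)), chartVolume_eq_on_overlap z (p i)
      ((hB.inter (hPm i)).inter hs) Set.inter_subset_right
      (Set.inter_subset_left.trans (Set.inter_subset_right.trans (hPs i))),
      Measure.restrict_apply hB]
    exact measure_mono Set.inter_subset_left
  refine le_antisymm ?_ (Measure.restrict_mono le_rfl (le_iSup (chartVolume (m := m)) x))
  refine Measure.le_iff.2 fun B hB => ?_
  have hs := (chartAt (EuclideanSpace ℝ (Fin m)) x).open_source.measurableSet
  rw [Measure.restrict_apply hB, Measure.restrict_apply hB]
  refine (hle _).trans ?_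
  rw [hsplit x _ (hB.inter hs), Measure.finsetSum_apply]
  refine Finset.sum_le_sum fun i _ => ?_
  rw [Measure.restrict_apply (hB.inter hs)]
  exact (chartVolume_eq_on_overlap (p i) x ((hB.inter hs).inter (hPm i))
    (Set.inter_subset_right.trans (hPs i))
    (Set.inter_subset_left.trans Set.inter_subset_right)).le

end Volume

/-! ### The expected number of critical points -/

theorem criticalCount_smul {m : ℕ} {M : Type*} [TopologicalSpace M]
    [ChartedSpace (EuclideanSpace ℝ (Fin m)) M] {V : Submodule ℝ C^∞⟮𝓡 m, M; ℝ⟯}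
    {h : InnerProductSpace.Core ℝ V} {r : ℝ} (hr : r ≠ 0) (v : SampleSpace V h) :
    criticalCount (r • v) = criticalCount v := by
  have : criticalSet (r • v) = criticalSet v := by
    ext x
    simp [criticalSet, hr]
  rw [criticalCount, criticalCount, this]

section Expectation

variable {m : ℕ} {M : Type*} [TopologicalSpace M] [CompactSpace M]
  [ChartedSpace (EuclideanSpace ℝ (Fin m)) M] [IsManifold (𝓡 m) ∞ M]
  [MeasurableSpace M] [BorelSpace M]
  [RiemannianBundle (fun x : M => TangentSpace (𝓡 m) x)]
  [IsContMDiffRiemannianBundle (𝓡 m) ∞ (EuclideanSpace ℝ (Fin m))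
    (fun x : M => TangentSpace (𝓡 m) x)]
  {V : Submodule ℝ C^∞⟮𝓡 m, M; ℝ⟯} {h : InnerProductSpace.Core ℝ V} [FiniteDimensional ℝ V]

/-- `exists_ball_lintegral_zeros` for the coordinate gradient, carried to `M` by the inverse chart;
`finrank_mul_zeroDensity` identifies the density. -/
theorem exists_open_lintegral_critical (hV : IsAmple V h) (x₀ : M) :
    ∃ O : Set M, IsOpen O ∧ x₀ ∈ O ∧ ∀ P ⊆ O, MeasurableSet P →
      AEMeasurable (fun v : SampleSpace V h => (((criticalSet v ∩ P).encard : ℕ∞) : ℝ≥0∞))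
        volume ∧
      (Module.finrank ℝ (SampleSpace V h) : ℝ≥0∞) *
        ∫⁻ v in ball (0 : SampleSpace V h) 1, ((criticalSet v ∩ P).encard : ℝ≥0∞) =
          ∫⁻ x in P, ENNReal.ofReal (criticalDensity V h x) ∂(riemannianVolume m M) ∧
      AEMeasurable (criticalDensity V h) ((riemannianVolume m M).restrict P) ∧
      ∫⁻ x in P, ENNReal.ofReal (criticalDensity V h x) ∂(riemannianVolume m M) < ⊤ := by
  set c := chartAt (EuclideanSpace ℝ (Fin m)) x₀ with hc
  have hx₀ : x₀ ∈ c.source := mem_chart_source _ x₀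
  obtain ⟨r, hr, hrU, hloc⟩ := exists_ball_lintegral_zeros (A := coordGradient V h x₀)
    c.open_target ((contDiffOn_coordGradient x₀).of_le (by simp))
    (fun y hy => coordGradient_surjective hV x₀ hy) (c.map_source hx₀)
  refine ⟨c.source ∩ c ⁻¹' ball (c x₀) r, c.isOpen_inter_preimage isOpen_ball,
    ⟨hx₀, mem_ball_self hr⟩, fun P hP hPm => ?_⟩
  set W := chartPart (m := m) x₀ P with hW
  have hWm : MeasurableSet W := measurableSet_chartPart x₀ hPm
  have hWt : W ⊆ c.target := Set.inter_subset_right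
  have hWb : W ⊆ ball (c x₀) r := by
    rintro y ⟨hy, hyt⟩
    have := (hP hy).2
    rwa [Set.mem_preimage, c.right_inv hyt] at this
  obtain ⟨h1, h2, h3, h4⟩ := hloc W hWb hWm
  have hcount : ∀ v : SampleSpace V h, (criticalSet v ∩ P).encard =
      {y ∈ W | coordGradient V h x₀ y v = 0}.encard := by
    intro v
    have hinj : Set.InjOn c.symm {y ∈ W | coordGradient V h x₀ y v = 0} :=
      c.symm.injOn.mono fun y hy => hWt hy.1
    rw [← hinj.encard_image]
    congr 1
    ext x
    constructor
    · rintro ⟨hx, hxP⟩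
      have hxs : x ∈ c.source := (hP hxP).1
      refine ⟨c x, ⟨⟨?_, c.map_source hxs⟩, ?_⟩, c.left_inv hxs⟩
      · change c.symm (c x) ∈ P
        rwa [c.left_inv hxs]
      · refine (coordGradient_eq_zero_iff x₀ (c.map_source hxs) v).2 ?_
        change adjunction (c.symm (c x)) v = 0
        rw [c.left_inv hxs]
        exact hx
    · rintro ⟨y, ⟨hy, hy0⟩, rfl⟩
      exact ⟨(coordGradient_eq_zero_iff x₀ (hWt hy) v).1 hy0, hy.1⟩
  set vd : EuclideanSpace ℝ (Fin m) → ℝ≥0∞ := fun y => ENNReal.ofReal (volumeDensity x₀ y) with hvd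
  have hvdm : AEMeasurable (volumeDensity x₀) (volume.restrict W) :=
    ((continuousOn_volumeDensity x₀).mono hWt).aemeasurable hWm
  set ν : Measure (EuclideanSpace ℝ (Fin m)) := (volume.restrict W).withDensity vd with hν
  have hνac : ν ≪ volume.restrict W := withDensity_absolutelyContinuous _ _
  have hsm : AEMeasurable c.symm ν :=
    ((aemeasurable_chart_symm x₀).mono_measure (Measure.restrict_mono hWt le_rfl)).mono_ac hνac
  have hmap : (riemannianVolume m M).restrict P = ν.map c.symm := by
    have hPs : P ⊆ c.source := fun x hx => (hP hx).1
    rw [← chartVolume_restrict x₀ hPm, ← Set.inter_eq_left.2 hPs, ← Measure.restrict_restrict hPm,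
      ← Measure.restrict_restrict hPm, riemannianVolume_restrict_source]
  have hgm : AEMeasurable (fun y => criticalDensity V h (c.symm y)) ν := by
    refine AEMeasurable.mono_ac ?_ hνac
    -- Measurability of `Δ / J` is inherited from the zero density: in coordinates it is `N` times
    -- that density divided by the positive volume density.
    have h5 : AEMeasurable (fun y => ((Module.finrank ℝ (SampleSpace V h) : ℝ≥0∞) *
        zeroDensity (coordGradient V h x₀) y).toReal / volumeDensity x₀ y)
        (volume.restrict W) :=
      (h3.const_mul _).ennreal_toReal.div hvdm
    refine h5.congr ?_
    filter_upwards [ae_restrict_mem hWm] with y hy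
    have hpos := volumeDensity_pos x₀ (hWt hy)
    rw [finrank_mul_zeroDensity hV x₀ (hWt hy), ENNReal.toReal_mul,
      ENNReal.toReal_ofReal (criticalDensity_nonneg _), ENNReal.toReal_ofReal hpos.le,
      mul_div_cancel_right₀ _ hpos.ne']
  have hcm : AEMeasurable (criticalDensity V h) ((riemannianVolume m M).restrict P) := by
    have hcm' : AEMeasurable c ((riemannianVolume m M).restrict P) :=
      (c.continuousOn.mono fun x hx => (hP hx).1).aemeasurable hPm
    have h6 : ((riemannianVolume m M).restrict P).map c = ν := by
      rw [hmap] at hcm' ⊢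
      rw [AEMeasurable.map_map_of_aemeasurable hcm' hsm]
      have : c ∘ c.symm =ᵐ[ν] id := by
        filter_upwards [hνac.ae_le (ae_restrict_mem hWm)] with y hy using c.right_inv (hWt hy)
      rw [Measure.map_congr this, Measure.map_id]
    have h7 : AEMeasurable ((fun y => criticalDensity V h (c.symm y)) ∘ c)
        ((riemannianVolume m M).restrict P) := by
      refine AEMeasurable.comp_aemeasurable ?_ hcm'
      rwa [h6]
    refine h7.congr ?_
    filter_upwards [ae_restrict_mem hPm] with x hx
    rw [Function.comp_apply, c.left_inv (hP hx).1]
  have hint : ∫⁻ x in P, ENNReal.ofReal (criticalDensity V h x) ∂(riemannianVolume m M) =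
      (Module.finrank ℝ (SampleSpace V h) : ℝ≥0∞) *
        ∫⁻ y in W, zeroDensity (coordGradient V h x₀) y := by
    have hcm2 := hcm.ennreal_ofReal
    rw [hmap] at hcm2 ⊢
    rw [lintegral_map' hcm2 hsm, hν, lintegral_withDensity_eq_lintegral_mul₀'
      hvdm.ennreal_ofReal hgm.ennreal_ofReal, ← lintegral_const_mul'' _ h3]
    refine setLIntegral_congr_fun hWm fun y hy => ?_
    rw [finrank_mul_zeroDensity hV x₀ (hWt hy), Pi.mul_apply, mul_comm]
  simp_rw [hcount]
  refine ⟨h1, ?_, hcm, ?_⟩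
  · rw [hint, h2]
  · rw [hint]
    exact ENNReal.mul_lt_top (ENNReal.natCast_lt_top _) h4

theorem lintegral_ball_criticalCount (hV : IsAmple V h) :
    AEMeasurable (fun v : SampleSpace V h => criticalCount v) volume ∧
    (Module.finrank ℝ (SampleSpace V h) : ℝ≥0∞) *
      ∫⁻ v in ball (0 : SampleSpace V h) 1, criticalCount v =
        ∫⁻ x, ENNReal.ofReal (criticalDensity V h x) ∂(riemannianVolume m M) ∧
    AEMeasurable (criticalDensity V h) (riemannianVolume m M) ∧
    ∫⁻ x, ENNReal.ofReal (criticalDensity V h x) ∂(riemannianVolume m M) < ⊤ := by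
  choose O hO hxO hloc using exists_open_lintegral_critical (V := V) (h := h) hV
  obtain ⟨n, p, P, hPm, hPd, hPu, hPO⟩ := exists_finite_measurable_partition hO hxO
  have hloc' := fun i => hloc (p i) (P i) (hPO i) (hPm i)
  have hcount : ∀ v : SampleSpace V h, criticalCount v =
      ∑ i, ((criticalSet v ∩ P i).encard : ℝ≥0∞) := by
    intro v
    rw [criticalCount, ← tsum_fintype (L := .unconditional _), ← encard_iUnion_eq_tsum,
      ← Set.inter_iUnion, hPu, Set.inter_univ]
    exact fun i j hij => (hPd hij).mono Set.inter_subset_right Set.inter_subset_right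
  have hsum : ∫⁻ x, ENNReal.ofReal (criticalDensity V h x) ∂(riemannianVolume m M) =
      ∑ i, ∫⁻ x in P i, ENNReal.ofReal (criticalDensity V h x) ∂(riemannianVolume m M) := by
    rw [← setLIntegral_univ, ← hPu, lintegral_iUnion hPm hPd, tsum_fintype]
  refine ⟨?_, ?_, ?_, ?_⟩
  · simp_rw [hcount]
    exact Finset.aemeasurable_fun_sum _ fun i _ => (hloc' i).1
  · simp_rw [hcount]
    rw [lintegral_finsetSum' _ fun i _ => (hloc' i).1.restrict, Finset.mul_sum, hsum]
    exact Finset.sum_congr rfl fun i _ => (hloc' i).2.1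
  · rw [← Measure.restrict_univ (μ := riemannianVolume m M), ← hPu, aemeasurable_iUnion_iff]
    exact fun i => (hloc' i).2.2.1
  · rw [hsum]
    exact ENNReal.sum_lt_top.2 fun i _ => (hloc' i).2.2.2

theorem aemeasurable_criticalCount (hV : IsAmple V h) :
    AEMeasurable (fun v : sphere (0 : SampleSpace V h) 1 => criticalCount (v : SampleSpace V h))
      (sphereArea (SampleSpace V h)) := by
  rcases subsingleton_or_nontrivial (SampleSpace V h) with hS | hS
  · exact Subsingleton.measurable.aemeasurable
  · exact aemeasurable_sphere_of_homogeneous (fun r hr v => criticalCount_smul hr.ne' v)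
      (lintegral_ball_criticalCount hV).1

theorem integrable_criticalDensity (hV : IsAmple V h) :
    Integrable (criticalDensity V h) (riemannianVolume m M) := by
  obtain ⟨-, -, h3, h4⟩ := lintegral_ball_criticalCount hV
  refine ⟨h3.aestronglyMeasurable, ?_⟩
  rwa [hasFiniteIntegral_iff_ofReal (Filter.Eventually.of_forall criticalDensity_nonneg)]

/-- The count is homogeneous of degree `0`, so its integral over the sphere is `N` times that over
the ball. -/
theorem expectation_eq (hV : IsAmple V h) :
    expectation V h = ENNReal.ofReal (1 / sigma (Module.finrank ℝ V - 1) *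
      ∫ x, criticalDensity V h x ∂(riemannianVolume m M)) := by
  obtain ⟨-, h2, -, -⟩ := lintegral_ball_criticalCount hV
  have hint := ofReal_integral_eq_lintegral_ofReal (integrable_criticalDensity hV)
    (Filter.Eventually.of_forall criticalDensity_nonneg)
  have hσ := sigma_pos (Module.finrank ℝ V - 1)
  rw [ENNReal.ofReal_mul (by positivity), hint, ← h2, expectation]
  -- If `V = 0`, the sphere is empty and the quotient is `0`, while the right side has the factor `N
  -- = 0`; the truncated index `N - 1` does no harm.
  rcases subsingleton_or_nontrivial (SampleSpace V h) with hS | hS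
  · have hempty : IsEmpty (sphere (0 : SampleSpace V h) 1) := by
      refine ⟨fun s => ?_⟩
      have := norm_eq_of_mem_sphere s
      rw [Subsingleton.elim (s : SampleSpace V h) 0, norm_zero] at this
      exact zero_ne_one this
    have hfr : Module.finrank ℝ (SampleSpace V h) = 0 := Module.finrank_zero_of_subsingleton
    rw [hfr, lintegral_of_isEmpty]
    simp
  · have hpolar := lintegral_sphere_of_homogeneous (E := SampleSpace V h) 0
      (φ := fun v => criticalCount v)
      (fun r hr v => by rw [criticalCount_smul hr.ne' v]; simp) (aemeasurable_criticalCount hV)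
    have harea : sphereArea (SampleSpace V h) Set.univ =
        ENNReal.ofReal (sigma (Module.finrank ℝ V - 1)) := sphereArea_univ
    rw [hpolar, harea, add_zero, ENNReal.div_eq_inv_mul, one_div, ENNReal.ofReal_inv_of_pos hσ]

end Expectation

/-! ### Homogeneous sample spaces -/

section SphereIsometry

variable {E F : Type*} [NormedAddCommGroup E] [InnerProductSpace ℝ E]
  [MeasurableSpace E] [BorelSpace E] [NormedAddCommGroup F] [InnerProductSpace ℝ F]
  [MeasurableSpace F] [BorelSpace F]

/-- The equivalence of unit spheres induced by a linear isometry. -/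
def sphereEquiv (e : E ≃ₗᵢ[ℝ] F) : sphere (0 : E) 1 ≃ᵐ sphere (0 : F) 1 :=
  (e.toHomeomorph.subtype fun x => by simp).toMeasurableEquiv

theorem coe_sphereEquiv (e : E ≃ₗᵢ[ℝ] F) (s : sphere (0 : E) 1) :
    (sphereEquiv e s : F) = e s := rfl

variable [FiniteDimensional ℝ E] [FiniteDimensional ℝ F]

/-- The area of a subset of the sphere is the dimension times the volume of the cone over it, and
`e` maps cones to cones preserving volume. -/
theorem measurePreserving_sphereEquiv (e : E ≃ₗᵢ[ℝ] F) :
    MeasurePreserving (sphereEquiv e) (sphereArea E) (sphereArea F) := by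
  refine ⟨(sphereEquiv e).measurable, Measure.ext fun s hs => ?_⟩
  rw [(sphereEquiv e).map_apply, sphereArea, sphereArea, Measure.toSphere_apply' _ hs,
    Measure.toSphere_apply' _ ((sphereEquiv e).measurable hs),
    e.toLinearEquiv.finrank_eq]
  congr 1
  rw [← e.measurePreserving.measure_preimage_emb e.toMeasurableEquiv.measurableEmbedding]
  congr 1
  ext v
  simp only [Set.mem_preimage, Set.mem_smul, Set.mem_image]
  constructor
  · rintro ⟨r, hr, _, ⟨u, hu, rfl⟩, rfl⟩
    exact ⟨r, hr, _, ⟨sphereEquiv e u, hu, rfl⟩, by rw [coe_sphereEquiv, map_smul]⟩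
  · rintro ⟨r, hr, _, ⟨u, hu, rfl⟩, huv⟩
    refine ⟨r, hr, _, ⟨(sphereEquiv e).symm u, ?_, rfl⟩, e.injective ?_⟩
    · rwa [(sphereEquiv e).apply_symm_apply]
    · rw [map_smul, ← coe_sphereEquiv, (sphereEquiv e).apply_symm_apply, huv]

end SphereIsometry

/-! ### Invariance of the density under symmetries -/

section Homogeneous

variable {m : ℕ} {M : Type*} [TopologicalSpace M] [ChartedSpace (EuclideanSpace ℝ (Fin m)) M]
  {V : Submodule ℝ C^∞⟮𝓡 m, M; ℝ⟯} {h : InnerProductSpace.Core ℝ V}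

theorem SampleSpace.ext_apply {u v : SampleSpace V h} (huv : ∀ x, u x = v x) : u = v :=
  Subtype.ext (ContMDiffMap.ext huv)

variable [RiemannianBundle (fun x : M => TangentSpace (𝓡 m) x)]
  {G : Type*} [Group G] [MulAction G M]

theorem exists_mfderiv_isometry (hG : IsHomogeneous V h G) (a : G) (x : M) :
    ∃ D : TangentSpace (𝓡 m) x ≃ₗᵢ[ℝ] TangentSpace (𝓡 m) (a • x),
      ∀ X, D X = mfderiv (𝓡 m) (𝓡 m) (fun z : M => a • z) x X := by
  let L : TangentSpace (𝓡 m) x →ₗᵢ[ℝ] TangentSpace (𝓡 m) (a • x) :=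
    { (mfderiv (𝓡 m) (𝓡 m) (fun z : M => a • z) x).toLinearMap with
      norm_map' := fun X => by
        have := hG.isometric a x X X
        rw [real_inner_self_eq_norm_sq, real_inner_self_eq_norm_sq] at this
        exact (sq_eq_sq₀ (norm_nonneg _) (norm_nonneg _)).1 this }
  -- Both tangent spaces are the model space, so the dimensions agree by `rfl` and the isometry is
  -- onto.
  exact ⟨L.toLinearIsometryEquiv rfl, fun X => rfl⟩

variable [FiniteDimensional ℝ V]

/-- The pullback of functions by an element of the group, as an isometry of the sample space. -/
theorem exists_pullback_isometry (hG : IsHomogeneous V h G) (a : G) :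
    ∃ ρ : SampleSpace V h ≃ₗᵢ[ℝ] SampleSpace V h, ∀ v x, ρ v x = v (a • x) := by
  choose ρ hρ using hG.pullback_mem a
  let L : SampleSpace V h →ₗᵢ[ℝ] SampleSpace V h :=
    { toFun := ρ
      map_add' := fun u v => SampleSpace.ext_apply fun x => by
        rw [hρ, SampleSpace.coe_add, SampleSpace.coe_add, Pi.add_apply, Pi.add_apply, hρ, hρ]
      map_smul' := fun c v => SampleSpace.ext_apply fun x => by
        rw [hρ, RingHom.id_apply, SampleSpace.coe_smul, SampleSpace.coe_smul, Pi.smul_apply,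
          Pi.smul_apply, hρ]
      norm_map' := fun v => by
        have := hG.inner_pullback a v v (ρ v) (ρ v) (hρ v) (hρ v)
        rw [real_inner_self_eq_norm_sq, real_inner_self_eq_norm_sq] at this
        exact (sq_eq_sq₀ (norm_nonneg _) (norm_nonneg _)).1 this }
  exact ⟨L.toLinearIsometryEquiv rfl, fun v x => hρ v x⟩

/-- `ρ` restricts to an isometry from the kernel space at `f x` to that at `x`, and the two Hessian
operators are conjugate by `D`. -/
theorem hessianAverage_comp {f : M → M} {x : M} {ρ : SampleSpace V h ≃ₗᵢ[ℝ] SampleSpace V h}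
    (D : TangentSpace (𝓡 m) x ≃ₗᵢ[ℝ] TangentSpace (𝓡 m) (f x))
    (hadj : ∀ v X, adjunction x (ρ v) X = adjunction (f x) v (D X))
    (hhess : ∀ v ∈ kernelSpace V h (f x), ∀ X Y, hessian (m := m) (ρ v).toSmooth x X Y =
      hessian (m := m) v.toSmooth (f x) (D X) (D Y)) :
    hessianAverage V h x = hessianAverage V h (f x) := by
  have hmem : ∀ v, ρ v ∈ kernelSpace V h x ↔ v ∈ kernelSpace V h (f x) := by
    intro v
    constructor
    · intro hv
      refine LinearMap.mem_ker.2 (ContinuousLinearMap.ext fun X => ?_)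
      obtain ⟨Y, rfl⟩ := D.surjective X
      rw [← hadj, LinearMap.mem_ker.1 hv]
      rfl
    · intro hv
      refine LinearMap.mem_ker.2 (ContinuousLinearMap.ext fun X => ?_)
      rw [hadj, LinearMap.mem_ker.1 hv]
      rfl
  let L : kernelSpace V h (f x) →ₗᵢ[ℝ] kernelSpace V h x :=
    { toFun := fun v => ⟨ρ v, (hmem v).2 v.2⟩
      map_add' := fun u v => Subtype.ext (map_add ρ (u : SampleSpace V h) v)
      map_smul' := fun c v => Subtype.ext (map_smul ρ c (v : SampleSpace V h))
      norm_map' := fun v => ρ.norm_map v }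
  have hL : Function.Surjective L := by
    rintro ⟨u, hu⟩
    refine ⟨⟨ρ.symm u, (hmem _).1 ?_⟩, Subtype.ext (ρ.apply_symm_apply u)⟩
    rwa [ρ.apply_symm_apply]
  let e := LinearIsometryEquiv.ofSurjective L hL
  rw [hessianAverage, hessianAverage,
    ← (measurePreserving_sphereEquiv e).integral_comp (sphereEquiv e).measurableEmbedding]
  refine integral_congr_ae (Filter.Eventually.of_forall fun v => ?_)
  have hv := v.1.2
  set T := hessianOperator (m := m) (ρ (v.1.1 : SampleSpace V h)).toSmooth x with hT
  set T' := hessianOperator (m := m) (v.1.1 : SampleSpace V h).toSmooth (f x) with hT'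
  have hconj : T'.toLinearMap =
      D.toLinearEquiv.toLinearMap ∘ₗ T.toLinearMap ∘ₗ D.toLinearEquiv.symm.toLinearMap := by
    ext X : 1
    refine ext_inner_right ℝ fun Y => ?_
    obtain ⟨X, rfl⟩ := D.surjective X
    obtain ⟨Y, rfl⟩ := D.surjective Y
    have h1 : ⟪T' (D X), D Y⟫_ℝ = ⟪T X, Y⟫_ℝ :=
      (inner_operatorOfBilin _ _ _).trans
        ((hhess _ hv X Y).symm.trans (inner_operatorOfBilin _ _ _).symm)
    refine h1.trans ?_
    rw [← D.inner_map_map (T X) Y]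
    simp
  change |LinearMap.det T.toLinearMap| = |LinearMap.det T'.toLinearMap|
  rw [hconj, LinearMap.det_conj]

/-- `𝒜†` at `x` is `ρ ∘ 𝒜† ∘ D` with `𝒜†` taken at `f x`; the isometries `ρ` and `D` do not change
Gram determinants in orthonormal bases. -/
theorem jacobian_dualAdjunction_comp {f : M → M} {x : M}
    {ρ : SampleSpace V h ≃ₗᵢ[ℝ] SampleSpace V h}
    (D : TangentSpace (𝓡 m) x ≃ₗᵢ[ℝ] TangentSpace (𝓡 m) (f x))
    (hadj : ∀ v X, adjunction x (ρ v) X = adjunction (f x) v (D X)) :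
    jacobian (dualAdjunction (V := V) (h := h) x) =
      jacobian (dualAdjunction (V := V) (h := h) (f x)) := by
  have hdual : ∀ X, dualAdjunction x X = ρ (dualAdjunction (f x) (D X)) := by
    intro X
    refine ext_inner_right ℝ fun v => ?_
    obtain ⟨v, rfl⟩ := ρ.surjective v
    rw [inner_dualAdjunction, hadj, ρ.inner_map_map, inner_dualAdjunction]
  rw [jacobian_eq ((stdOrthonormalBasis ℝ (TangentSpace (𝓡 m) x)).map D), jacobian]
  congr 2
  ext i j
  simp only [Matrix.gram, Matrix.of_apply, hdual, ρ.inner_map_map, OrthonormalBasis.map_apply]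

variable [IsManifold (𝓡 m) ∞ M]

/-- In a chart `c`, `v ∘ f ∘ c⁻¹` is both `ρ v` along `c⁻¹` and `v` along `f ∘ c⁻¹`. At a critical
point its second derivative computes both Hessians, which are therefore related by `df`. -/
theorem criticalDensity_comp {f : M → M} (hf : ContMDiff (𝓡 m) (𝓡 m) ∞ f)
    {ρ : SampleSpace V h ≃ₗᵢ[ℝ] SampleSpace V h} (hρ : ∀ v x, ρ v x = v (f x)) (x : M)
    (hD : ∀ x, ∃ D : TangentSpace (𝓡 m) x ≃ₗᵢ[ℝ] TangentSpace (𝓡 m) (f x),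
      ∀ X, D X = mfderiv (𝓡 m) (𝓡 m) f x X) :
    criticalDensity V h x = criticalDensity V h (f x) := by
  -- The coordinate lemmas speak of points of the form `c.symm y`; `x` has this form only up to a
  -- propositional equality, on which its tangent space depends.
  suffices key : ∀ y ∈ (chartAt (EuclideanSpace ℝ (Fin m)) x).target,
      criticalDensity V h ((chartAt (EuclideanSpace ℝ (Fin m)) x).symm y) =
        criticalDensity V h (f ((chartAt (EuclideanSpace ℝ (Fin m)) x).symm y)) by
    have hx := mem_chart_source (EuclideanSpace ℝ (Fin m)) x
    have := key _ ((chartAt (EuclideanSpace ℝ (Fin m)) x).map_source hx)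
    rwa [(chartAt (EuclideanSpace ℝ (Fin m)) x).left_inv hx] at this
  intro y hy
  set c := chartAt (EuclideanSpace ℝ (Fin m)) x with hc
  have hcs : ContMDiffAt (𝓡 m) (𝓡 m) ∞ c.symm y := contMDiffAt_chart_symm hy
  obtain ⟨D, hDf⟩ := hD (c.symm y)
  have hρf : ∀ v : SampleSpace V h, ((ρ v).toSmooth : M → ℝ) = (v.toSmooth : M → ℝ) ∘ f :=
    fun v => funext (hρ v)
  have hadj : ∀ (v : SampleSpace V h) X,
      adjunction (c.symm y) (ρ v) X = adjunction (f (c.symm y)) v (D X) := by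
    intro v X
    have h1 : mfderiv (𝓡 m) 𝓘(ℝ, ℝ) ((v.toSmooth : M → ℝ) ∘ f) (c.symm y) =
        (mfderiv (𝓡 m) 𝓘(ℝ, ℝ) v.toSmooth (f (c.symm y))).comp
          (mfderiv (𝓡 m) (𝓡 m) f (c.symm y)) :=
      mfderiv_comp _ (v.mdifferentiableAt _) (hf.mdifferentiableAt (by simp))
    rw [hDf]
    change mfderiv (𝓡 m) 𝓘(ℝ, ℝ) ((ρ v).toSmooth : M → ℝ) (c.symm y) X = _
    rw [hρf, h1]
    rfl
  have hhess : ∀ v ∈ kernelSpace V h (f (c.symm y)), ∀ X Y,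
      hessian (m := m) (ρ v).toSmooth (c.symm y) X Y =
        hessian (m := m) v.toSmooth (f (c.symm y)) (D X) (D Y) := by
    intro v hv X Y
    obtain ⟨X, rfl⟩ := (coordFrame x hy).surjective X
    obtain ⟨Y, rfl⟩ := (coordFrame x hy).surjective Y
    have hv0 : adjunction (f (c.symm y)) v = 0 := LinearMap.mem_ker.1 hv
    have hρ0 : adjunction (c.symm y) (ρ v) = 0 := by
      ext Z
      rw [hadj, hv0]
      rfl
    have h1 := fderiv_fderiv_comp_eq_hessian (ρ v).toSmooth.contMDiff hcs hρ0 X Y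
    have h2 := fderiv_fderiv_comp_eq_hessian (ψ := f ∘ c.symm) v.toSmooth.contMDiff
      (hf.contMDiffAt.comp y hcs) hv0 X Y
    have h3 : ((ρ v).toSmooth : M → ℝ) ∘ c.symm = v.toSmooth ∘ (f ∘ c.symm) := by
      rw [hρf]
      rfl
    rw [h3] at h1
    have h4 : mfderiv (𝓡 m) (𝓡 m) (f ∘ c.symm) y =
        (mfderiv (𝓡 m) (𝓡 m) f (c.symm y)).comp (mfderiv (𝓡 m) (𝓡 m) c.symm y) :=
      mfderiv_comp y (hf.mdifferentiableAt (by simp)) (hcs.mdifferentiableAt (by simp))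
    rw [h4] at h2
    rw [hDf, hDf]
    exact h1.symm.trans h2
  rw [criticalDensity, criticalDensity, hessianAverage_comp D hadj hhess,
    jacobian_dualAdjunction_comp D hadj]

theorem criticalDensity_eq_of_isHomogeneous {k : ℕ} [TopologicalSpace G]
    [ChartedSpace (EuclideanSpace ℝ (Fin k)) G] [ContMDiffSMul (𝓡 k) (𝓡 m) ∞ G M]
    (hG : IsHomogeneous V h G) (x y : M) : criticalDensity V h x = criticalDensity V h y := by
  obtain ⟨a, rfl⟩ := hG.transitive x y
  obtain ⟨ρ, hρ⟩ := exists_pullback_isometry hG a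
  have hsm : ContMDiff (𝓡 m) (𝓡 m) ∞ fun z : M => a • z :=
    (contMDiff_smul (I := 𝓡 k) (I' := 𝓡 m) (n := ∞) (G := G) (M := M)).comp
      (contMDiff_const.prodMk contMDiff_id)
  exact criticalDensity_comp hsm hρ x fun z => exists_mfderiv_isometry hG a z

end Homogeneous

end CriticalSets

end

/-! ### The theorem -/

theorem corollary1p4 {m : ℕ} {M : Type*} [TopologicalSpace M] [T2Space M] [CompactSpace M]
    [ConnectedSpace M] [ChartedSpace (EuclideanSpace ℝ (Fin m)) M] [IsManifold (𝓡 m) ∞ M]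
    [MeasurableSpace M] [BorelSpace M]
    -- the Riemannian metric `g`
    [RiemannianBundle (fun x : M => TangentSpace (𝓡 m) x)]
    [IsContMDiffRiemannianBundle (𝓡 m) ∞ (EuclideanSpace ℝ (Fin m))
      (fun x : M => TangentSpace (𝓡 m) x)]
    (V : Submodule ℝ C^∞⟮𝓡 m, M; ℝ⟯) [FiniteDimensional ℝ V]
    (h : InnerProductSpace.Core ℝ V) (hV : CriticalSets.IsAmple V h) :
    AEMeasurable (fun v : sphere (0 : CriticalSets.SampleSpace V h) 1 =>
        CriticalSets.criticalCount (v : CriticalSets.SampleSpace V h))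
      (CriticalSets.sphereArea (CriticalSets.SampleSpace V h)) ∧
    Integrable (CriticalSets.criticalDensity V h) (CriticalSets.riemannianVolume m M) ∧
    CriticalSets.expectation V h =
      ENNReal.ofReal (1 / CriticalSets.sigma (Module.finrank ℝ V - 1) *
        ∫ x, CriticalSets.criticalDensity V h x ∂(CriticalSets.riemannianVolume m M)) ∧
    ∀ (k : ℕ) (G : Type*) [Group G] [TopologicalSpace G] [T2Space G] [CompactSpace G]
      [ChartedSpace (EuclideanSpace ℝ (Fin k)) G] [LieGroup (𝓡 k) ∞ G]
      [MulAction G M] [ContMDiffSMul (𝓡 k) (𝓡 m) ∞ G M],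
      CriticalSets.IsHomogeneous V h G →
        (∀ x y : M, CriticalSets.criticalDensity V h x = CriticalSets.criticalDensity V h y) ∧
        ∀ x₀ : M, CriticalSets.expectation V h =
          ENNReal.ofReal (CriticalSets.criticalDensity V h x₀ /
              CriticalSets.sigma (Module.finrank ℝ V - 1)) *
            CriticalSets.riemannianVolume m M Set.univ := by
  refine ⟨CriticalSets.aemeasurable_criticalCount hV, CriticalSets.integrable_criticalDensity hV,
    CriticalSets.expectation_eq hV, ?_⟩
  intro k G _ _ _ _ _ _ _ _ hG
  have hconst := fun x y => CriticalSets.criticalDensity_eq_of_isHomogeneous (k := k) hG x y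
  refine ⟨hconst, fun x₀ => ?_⟩
  have hσ := CriticalSets.sigma_pos (Module.finrank ℝ V - 1)
  have hfun : CriticalSets.criticalDensity V h = fun _ => CriticalSets.criticalDensity V h x₀ :=
    funext fun x => hconst x x₀
  have hint := CriticalSets.integrable_criticalDensity hV
  rw [CriticalSets.expectation_eq hV]
  rw [hfun] at hint
  have hintegral : ∫ x, CriticalSets.criticalDensity V h x ∂(CriticalSets.riemannianVolume m M) =
      (CriticalSets.riemannianVolume m M).real Set.univ * CriticalSets.criticalDensity V h x₀ := by
    rw [hfun, integral_const, smul_eq_mul]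
  rw [hintegral]
  -- Finiteness of the volume is read off from integrability of the constant density. If the
  -- constant is `0` the volume is not needed, since `0 * ∞ = 0` in `ℝ≥0∞`.
  rcases integrable_const_iff.1 hint with h0 | hfin
  · simp [h0]
  · rw [← ENNReal.ofReal_toReal (measure_ne_top (CriticalSets.riemannianVolume m M) Set.univ),
      ← ENNReal.ofReal_mul (div_nonneg (CriticalSets.criticalDensity_nonneg x₀) hσ.le)]
    congr 1
    rw [Measure.real]
    ring
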